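/- Lemma 5 (type covering lemma for the lossy Gray-Wyner problem). All logarithms are to base $2$. Let $\mathcal X,\mathcal Y,\mathcal W,\hat{\mathcal X},\hat{\mathcal Y}$ be finite alphabets, $d_X:\mathcal X\times\hat{\mathcal X}\to[0,\infty)$ and $d_Y:\mathcal Y\times\hat{\mathcal Y}\to[0,\infty)$ distortion measures such that for every $x$ there is $\hat x$ with $d_X(x,\hat x)=0$ and for every $y$ there is $\hat y$ with $d_Y(y,\hat y)=0$. Put $\overline d_X=\max d_X$, $\underline d_X=\min\{d_X(x,\hat x):d_X(x,\hat x)>0\}$, similarly $\overline d_Y,\underline d_Y$ (a ratio $\overline d/\underline d$ is read as $0$ if $d\equiv 0$), and $d_X(x^n,\hat x^n)=\frac1n\sum_i d_X(x_i,\hat x_i)$, similarly $d_Y(y^n,\hat y^n)$. Let $D_1,D_2>0$ and $$c_0=3|\mathcal X||\mathcal Y||\mathcal W|+4,$$ $$c_1=\frac{11\overline d_X}{\underline d_X}|\mathcal X||\mathcal Y||\mathcal W|+3|\mathcal X||\mathcal W||\hat{\mathcal X}|+5,\qquad c_2=\frac{11\overline d_Y}{\underline d_Y}|\mathcal X||\mathcal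 Y||\mathcal W|+3|\mathcal Y||\mathcal W||\hat{\mathcal Y}|+5 .$$ For a distribution $P_{XY}$ on $\mathcal X\times\mathcal Y$, call $(R_0,R_1,R_2)$ $(D_1,D_2)$-achievable if there are, for every $n$, encoders $f_j:\mathcal X^n\times\mathcal Y^n\to\{1,\dots,M_j\}$, $j=0,1,2$, and decoders $\phi_1:\{1,\dots,M_0\}\times\{1,\dots,M_1\}\to\hat{\mathcal X}^n$, $\phi_2:\{1,\dots,M_0\}\times\{1,\dots,M_2\}\to\hat{\mathcal Y}^n$ (all depending on $n$) such that $\limsup_n\frac1n\log M_j\le R_j$ for $j=0,1,2$ and, for $(X_i,Y_i)$ i.i.d. with law $P_{XY}$, $\hat X^n=\phi_1(f_0,f_1)$ and $\hat Y^n=\phi_2(f_0,f_2)$, $\limsup_n\mathbb E[d_X(X^n,\hat X^n)]\le D_1$ and $\limsup_n\mathbb E[d_Y(Y^n,\hat Y^n)]\le D_2$. Let $\mathcal R(D_1,D_2|P_{XY})$ be the closure of the set of achievable triplets and $$\mathsf R_0(R_1,R_2,D_1,D_2|P_{XY})=\min\{R_0:(R_0,R_1,R_2)\in\mathcal R(D_1,D_2|P_{XY})\}.$$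 Let $R_{X|W}(P_{XW},D)=\inf\{I(X;\hat X|W):P_{\hat X|XW},\ \mathbb E[d_X(X,\hat X)]\le D\}$ be the conditional rate-distortion function, and similarly $R_{Y|W}$. A test channel $P_{W|XY}$ achieves $\mathsf R_0(R_1,R_2,D_1,D_2|P_{XY})$ if, under $P_{XY}\times P_{W|XY}$, $R_{X|W}(P_{XW},D_1)\le R_1$, $R_{Y|W}(P_{YW},D_2)\le R_2$ and $I(X,Y;W)=\mathsf R_0(R_1,R_2,D_1,D_2|P_{XY})$. Let $n\ge1$ satisfy $(n+1)^4>n\log(|\mathcal X||\mathcal Y|)$, $\log n\ge\frac{|\mathcal X||\mathcal W||\hat{\mathcal X}|\,\log|\mathcal X|\;\overline d_X}{D_1}$, $\log n\ge\frac{|\mathcal Y||\mathcal W||\hat{\mathcal Y}|\,\log|\mathcal Y|\;\overline d_Y}{D_2}$ and $\log n\ge\log\frac{|\hat{\mathcal X}|}{|\mathcal Y|}$. Let $Q_{XY}$ be a joint type of sequences of length $n$ on $\mathcal X\times\mathcal Y$ and let $R_1,R_2>0$ be such that $\mathsf R_0(R_1,R_2,D_1,D_2|Q_{XY})$ is achieved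 by some test channel with output alphabet $\mathcal W$. Then there is a conditional type $Q_{W|XY}$ for $Q_{XY}$ (that is, a conditional distribution such that every $(x^n,y^n)$ of type $Q_{XY}$ has a $w^n$ for which $(x^n,y^n,w^n)$ has joint type $Q_{XYW}:=Q_{XY}\times Q_{W|XY}$) such that, with $Q_W$ the $\mathcal W$-marginal of $Q_{XYW}$ and $\mathcal T_Q$ the set of sequences of type $Q$: 1. There is a set $\mathcal C_n\subset\mathcal T_{Q_W}$ such that for every $(x^n,y^n)\in\mathcal T_{Q_{XY}}$ there is $w^n\in\mathcal C_n$ with $(x^n,y^n,w^n)\in\mathcal T_{Q_{XYW}}$, and $$\frac1n\log|\mathcal C_n|\le\mathsf R_0(R_1,R_2,D_1,D_2|Q_{XY})+c_0\frac{\log(n+1)}n.$$ 2. For every $w^n\in\mathcal T_{Q_W}$ there are sets $\mathcal B_{\hat X}(w^n)\subset\hat{\mathcal X}^n$ and $\mathcal B_{\hat Y}(w^n)\subset\hat{\mathcal Y}^n$ such that for every $(x^n,y^n)$ with $(x^n,y^n,w^n)\in\mathcal T_{Q_{XYW}}$ there are $\hat x^n\in\mathcal B_{\hat X}(w^n)$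 and $\hat y^n\in\mathcal B_{\hat Y}(w^n)$ with $d_X(x^n,\hat x^n)\le D_1$ and $d_Y(y^n,\hat y^n)\le D_2$, and $$\frac1n\log|\mathcal B_{\hat X}(w^n)|\le R_1+c_1\frac{\log n}n,\qquad \frac1n\log|\mathcal B_{\hat Y}(w^n)|\le R_2+c_2\frac{\log n}n.$$ -/

import Mathlib

namespace GrayWyner

open Finset Filter

section Types

variable {α β : Type*} [Fintype α] [DecidableEq α] [Fintype β] [DecidableEq β]

/-- The empirical distribution of a sequence of length `n`. -/
noncomputable def empirical {n : ℕ} (x : Fin n → α) : α → ℝ :=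
  fun a => ((univ.filter fun i => x i = a).card : ℝ) / n

/-- The type class `T_P`: all sequences of length `n` with empirical distribution `P`. -/
def typeClass (n : ℕ) (P : α → ℝ) : Set (Fin n → α) :=
  {x | empirical x = P}

/-- `P` is a type of length-`n` sequences. -/
def IsType (n : ℕ) (P : α → ℝ) : Prop :=
  ∃ x : Fin n → α, empirical x = P

/-- `V` is a conditional probability distribution from `α` to `β`; `V a b` is `V(b|a)`. -/
def IsChannel (V : α → β → ℝ) : Prop :=
  ∀ a, V a ∈ stdSimplex ℝ β

/-- The joint distribution `P × V`. -/
def jointDist (P : α → ℝ) (V : α → β → ℝ) : α × β → ℝ :=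
  fun p => P p.1 * V p.1 p.2

/-- The output distribution of the channel `V` when the input has distribution `P`. -/
def outputDist (P : α → ℝ) (V : α → β → ℝ) : β → ℝ :=
  fun b => ∑ a, P a * V a b

/-- The sequence of pairs formed from two sequences of the same length. -/
def pairSeq {n : ℕ} (x : Fin n → α) (y : Fin n → β) : Fin n → α × β :=
  fun i => (x i, y i)

/-- The conditional type class `T_V(x)`: all `y` such that the joint type of `(x, y)` is
`P × V`, where `P` is the type of `x`. -/
def condTypeClass {n : ℕ} (V : α → β → ℝ) (x : Fin n → α) : Set (Fin n → β) :=
  {y | empirical (pairSeq x y) = jointDist (empirical x) V}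

/-- `V` is a conditional type given the type `P`, i.e. a channel such that `T_V(x)` is not
empty for `x` in `T_P`. -/
def IsCondType (n : ℕ) (P : α → ℝ) (V : α → β → ℝ) : Prop :=
  IsChannel V ∧ ∀ x ∈ typeClass n P, (condTypeClass V x).Nonempty

end Types

section Information

variable {α β γ : Type*} [Fintype α] [Fintype β] [Fintype γ]

/-- Mutual information `I(P, V)` in bits. Terms with `P(a) V(b|a) = 0` vanish, and in the other
ones the denominator is positive. -/
noncomputable def mutualInfo (P : α → ℝ) (V : α → β → ℝ) : ℝ :=
  ∑ a, ∑ b, P a * V a b * Real.logb 2 (V a b / outputDist P V b)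

/-- The conditional distribution of the reproduction letter given the side information `w`, when
`(A, W)` has distribution `P` and the reproduction is generated from `(A, W)` by `V`. -/
noncomputable def condOutputDist (P : α × β → ℝ) (V : α × β → γ → ℝ) (w : β) : γ → ℝ :=
  fun c => (∑ a, P (a, w) * V (a, w) c) / ∑ a, P (a, w)

/-- Conditional mutual information `I(A; C | W)` in bits, for `(A, W) ∼ P` and `C` generated from
`(A, W)` by `V`. -/
noncomputable def condMutualInfo (P : α × β → ℝ) (V : α × β → γ → ℝ) : ℝ :=
  ∑ a, ∑ w, ∑ c, P (a, w) * V (a, w) c *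
    Real.logb 2 (V (a, w) c / condOutputDist P V w c)

/-- The expected distortion `E[d(A, C)]` for `(A, W) ∼ P` and `C` generated from `(A, W)` by
`V`. -/
def expectedDistortion (d : α → γ → ℝ) (P : α × β → ℝ) (V : α × β → γ → ℝ) : ℝ :=
  ∑ a, ∑ w, ∑ c, P (a, w) * V (a, w) c * d a c

/-- The conditional rate-distortion function `R_{A|W}(P, D)` in bits. -/
noncomputable def condRateDistortion (d : α → γ → ℝ) (P : α × β → ℝ) (D : ℝ) : ℝ :=
  sInf {r | ∃ V : α × β → γ → ℝ, (∀ p, V p ∈ stdSimplex ℝ γ) ∧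
    expectedDistortion d P V ≤ D ∧ r = condMutualInfo P V}

/-- The largest value of a distortion measure. -/
noncomputable def maxDistortion (d : α → γ → ℝ) : ℝ :=
  ⨆ p : α × γ, d p.1 p.2

/-- The smallest positive value of a distortion measure (`0` by convention if there is none). -/
noncomputable def minPosDistortion (d : α → γ → ℝ) : ℝ :=
  sInf {r | 0 < r ∧ ∃ a c, d a c = r}

/-- The average distortion between two sequences of length `n`. -/
noncomputable def avgDistortion (d : α → γ → ℝ) {n : ℕ} (x : Fin n → α) (z : Fin n → γ) : ℝ :=
  (∑ i, d (x i) (z i)) / n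

end Information

section Region

/-- An `(n, M₀, M₁, M₂)`-code for lossy Gray-Wyner source coding. -/
structure Code (X Y Xh Yh : Type*) (n M₀ M₁ M₂ : ℕ) where
  enc₀ : (Fin n → X) → (Fin n → Y) → Fin M₀
  enc₁ : (Fin n → X) → (Fin n → Y) → Fin M₁
  enc₂ : (Fin n → X) → (Fin n → Y) → Fin M₂
  dec₁ : Fin M₀ → Fin M₁ → Fin n → Xh
  dec₂ : Fin M₀ → Fin M₂ → Fin n → Yh

variable {X Y Xh Yh W : Type*} [Fintype X] [DecidableEq X] [Fintype Y] [DecidableEq Y]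
  [Fintype Xh] [Fintype Yh] [Fintype W]

/-- The expectation of `g(X^n, Y^n)` when the pairs `(X_i, Y_i)` are i.i.d. with law `P`. -/
def expectIID (P : X × Y → ℝ) {n : ℕ} (g : (Fin n → X) → (Fin n → Y) → ℝ) : ℝ :=
  ∑ x, ∑ y, (∏ i, P (x i, y i)) * g x y

/-- The rate triplet `(R₀, R₁, R₂)` is `(D₁, D₂)`-achievable for the memoryless source `P`. The
upper limits are taken in the extended reals. -/
def IsAchievable (dX : X → Xh → ℝ) (dY : Y → Yh → ℝ) (D₁ D₂ : ℝ) (P : X × Y → ℝ)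
    (R₀ R₁ R₂ : ℝ) : Prop :=
  ∃ (M₀ M₁ M₂ : ℕ → ℕ) (c : ∀ n, Code X Y Xh Yh n (M₀ n) (M₁ n) (M₂ n)),
    limsup (fun n : ℕ => ((1 / (n : ℝ) * Real.logb 2 (M₀ n) : ℝ) : EReal)) atTop ≤ (R₀ : EReal) ∧
    limsup (fun n : ℕ => ((1 / (n : ℝ) * Real.logb 2 (M₁ n) : ℝ) : EReal)) atTop ≤ (R₁ : EReal) ∧
    limsup (fun n : ℕ => ((1 / (n : ℝ) * Real.logb 2 (M₂ n) : ℝ) : EReal)) atTop ≤ (R₂ : EReal) ∧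
    limsup (fun n : ℕ => ((expectIID P fun x y => avgDistortion dX x
      ((c n).dec₁ ((c n).enc₀ x y) ((c n).enc₁ x y)) : ℝ) : EReal)) atTop ≤ (D₁ : EReal) ∧
    limsup (fun n : ℕ => ((expectIID P fun x y => avgDistortion dY y
      ((c n).dec₂ ((c n).enc₀ x y) ((c n).enc₂ x y)) : ℝ) : EReal)) atTop ≤ (D₂ : EReal)

/-- The `(D₁, D₂)`-optimal rate region: the closure of the set of achievable rate triplets. -/
def rateRegion (dX : X → Xh → ℝ) (dY : Y → Yh → ℝ) (D₁ D₂ : ℝ) (P : X × Y → ℝ) :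
    Set (ℝ × ℝ × ℝ) :=
  closure {r | IsAchievable dX dY D₁ D₂ P r.1 r.2.1 r.2.2}

/-- The minimum common rate `R₀(R₁, R₂, D₁, D₂ | P)`. -/
noncomputable def minCommonRate (dX : X → Xh → ℝ) (dY : Y → Yh → ℝ) (R₁ R₂ D₁ D₂ : ℝ)
    (P : X × Y → ℝ) : ℝ :=
  sInf {R₀ | (R₀, R₁, R₂) ∈ rateRegion dX dY D₁ D₂ P}

/-- The `X × W`-marginal of `P × V`. -/
def margXW (P : X × Y → ℝ) (V : X × Y → W → ℝ) : X × W → ℝ :=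
  fun p => ∑ y, P (p.1, y) * V (p.1, y) p.2

/-- The `Y × W`-marginal of `P × V`. -/
def margYW (P : X × Y → ℝ) (V : X × Y → W → ℝ) : Y × W → ℝ :=
  fun p => ∑ x, P (x, p.1) * V (x, p.1) p.2

/-- The test channel `V` achieves the minimum common rate: it satisfies the two constraints on
the conditional rate-distortion functions and `I(X, Y; W) = R₀(R₁, R₂, D₁, D₂ | P)`. -/
def AchievesMinCommonRate (dX : X → Xh → ℝ) (dY : Y → Yh → ℝ) (R₁ R₂ D₁ D₂ : ℝ)
    (P : X × Y → ℝ) (V : X × Y → W → ℝ) : Prop :=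
  IsChannel V ∧
  condRateDistortion dX (margXW P V) D₁ ≤ R₁ ∧
  condRateDistortion dY (margYW P V) D₂ ≤ R₂ ∧
  mutualInfo P V = minCommonRate dX dY R₁ R₂ D₁ D₂ P

end Region

section Constants

/-- The constant `c₀`. -/
def const₀ (X Y W : Type*) [Fintype X] [Fintype Y] [Fintype W] : ℝ :=
  3 * Fintype.card X * Fintype.card Y * Fintype.card W + 4

/-- The constant `c₁`. -/
noncomputable def const₁ {X Xh : Type*} (Y W : Type*) [Fintype X] [Fintype Y] [Fintype W]
    [Fintype Xh] (dX : X → Xh → ℝ) : ℝ :=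
  11 * maxDistortion dX / minPosDistortion dX *
      (Fintype.card X * Fintype.card Y * Fintype.card W) +
    3 * Fintype.card X * Fintype.card W * Fintype.card Xh + 5

/-- The constant `c₂`. -/
noncomputable def const₂ {Y Yh : Type*} (X W : Type*) [Fintype X] [Fintype Y] [Fintype W]
    [Fintype Yh] (dY : Y → Yh → ℝ) : ℝ :=
  11 * maxDistortion dY / minPosDistortion dY *
      (Fintype.card X * Fintype.card Y * Fintype.card W) +
    3 * Fintype.card Y * Fintype.card W * Fintype.card Yh + 5

end Constants

end GrayWyner

open GrayWyner

namespace GrayWyner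

open Finset

-- The theorem is a statement about finite sequences, proved by the method of types. Achievability
-- enters only through the given test channel `P`, whose mutual information equals the minimum
-- common rate and whose conditional rate-distortion functions are within `R₁` and `R₂`. `P` is
-- rounded to a conditional type `V` with every joint probability off by at most `1/n`, and the same
-- `V` serves all three covers.
--
-- Each cover is greedy (`exists_cover`): if a law on codewords gives every target a set of good
-- codewords of probability at least `p`, then `(log |S| + 1) / p` codewords serve all targets in
-- `S`. For targets of one type and a product law (`exists_type_cover`), `1/p` is at most
-- `(n+1)^(|α||β|)` times the exponential of the divergence from the sampling law to the desired
-- conditional type. This follows because a conditional type class is the most probable one under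
-- its own conditional type (`one_le_prob_condClass`).
--
-- For the common codebook the sampling law is the output distribution of `V`, and the divergence is
-- `n I(Q, V)`. Entropy varies by `O(log(n+1)/n)` under changes of `1/n`, so `I(Q, V)` may be
-- replaced by `I(Q, P)` (`mutualInfo_le_of_near`).
--
-- For a private codebook the rate constraint holds at the marginal of `P`, while the sequences have
-- the marginal of `V`. A nearly optimal reproduction channel is rounded down inside each cell of
-- equal source letter and equal side information, and the boundedly many leftover positions receive
-- a reproduction letter of distortion zero (`exists_cell_counts`). The distortion therefore never
-- exceeds that of the channel. To keep those letters affordable, the sampling law is mixed with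
-- weight `1/n` with a fixed law charging all of them, so each leftover position costs only `O(log
-- n)` in the exponent (`exists_counts_of_channel`, `exists_distortion_cover`).

/-- The number of occurrences of a letter in a sequence. -/
def count {α : Type*} [DecidableEq α] {n : ℕ} (s : Fin n → α) (a : α) : ℕ :=
  (univ.filter fun i => s i = a).card

-- Counting sequences in conditional type classes.

section Counting

variable {α β : Type*} [DecidableEq α] [DecidableEq β] {n : ℕ}

theorem count_eq_card (s : Fin n → α) (a : α) :
    count s a = Fintype.card {i // s i = a} := by
  rw [Fintype.card_subtype]; rfl

theorem count_pos_apply (s : Fin n → α) (i : Fin n) : 0 < count s (s i) :=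
  Finset.card_pos.2 ⟨i, by simp⟩

theorem sum_count_pairSeq [Fintype β] (u : Fin n → α) (w : Fin n → β) (a : α) :
    ∑ b, count (pairSeq u w) (a, b) = count u a := by
  have := Finset.card_eq_sum_card_fiberwise (f := w) (s := univ.filter fun i => u i = a)
    (t := univ) (by simp)
  unfold count
  rw [this]
  refine sum_congr rfl fun b _ => ?_
  rw [filter_filter]
  simp [pairSeq]

theorem count_comp_perm (s : Fin n → α) (g : Equiv.Perm (Fin n)) (a : α) :
    count (s ∘ g) a = count s a := by
  rw [count_eq_card, count_eq_card]
  exact Fintype.card_congr (g.subtypeEquiv fun i => Iff.rfl)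

theorem exists_perm_of_count_eq {s s' : Fin n → α} (h : ∀ a, count s a = count s' a) :
    ∃ g : Equiv.Perm (Fin n), s ∘ g = s' := by
  have e : ∀ a, {i // s' i = a} ≃ {i // s i = a} := fun a =>
    Fintype.equivOfCardEq (by rw [← count_eq_card, ← count_eq_card, h])
  exact ⟨Equiv.ofFiberEquiv e, funext fun i => Equiv.ofFiberEquiv_map e i⟩

theorem exists_count_pairSeq_eq [Fintype β] (u : Fin n → α) (N : α × β → ℕ)
    (hN : ∀ a, ∑ b, N (a, b) = count u a) :
    ∃ w : Fin n → β, ∀ p, count (pairSeq u w) p = N p := by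
  have e : ∀ a, {i // u i = a} ≃ Σ b, Fin (N (a, b)) := fun a =>
    Fintype.equivOfCardEq (by rw [← count_eq_card, ← hN]; simp)
  refine ⟨fun i => (e (u i) ⟨i, rfl⟩).1, ?_⟩
  rintro ⟨a, b⟩
  rw [count_eq_card]
  have key : ∀ i, pairSeq u (fun i => (e (u i) ⟨i, rfl⟩).1) i = (a, b) ↔
      ∃ h : u i = a, (e a ⟨i, h⟩).1 = b := by
    intro i
    simp only [pairSeq, Prod.mk.injEq]
    constructor
    · rintro ⟨rfl, h⟩
      exact ⟨rfl, h⟩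
    · rintro ⟨rfl, h⟩
      exact ⟨rfl, h⟩
  have e1 : {i // pairSeq u (fun i => (e (u i) ⟨i, rfl⟩).1) i = (a, b)} ≃
      {j : {i // u i = a} // (e a j).1 = b} :=
    { toFun := fun i => ⟨⟨i.1, ((key i.1).1 i.2).1⟩, ((key i.1).1 i.2).2⟩
      invFun := fun j => ⟨j.1.1, (key j.1.1).2 ⟨j.1.2, j.2⟩⟩
      left_inv := fun i => rfl
      right_inv := fun j => rfl }
  have e2 : {j : {i // u i = a} // (e a j).1 = b} ≃ {j : Σ b, Fin (N (a, b)) // j.1 = b} :=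
    (e a).subtypeEquiv fun _ => Iff.rfl
  rw [Fintype.card_congr ((e1.trans e2).trans (Equiv.sigmaSubtype b))]
  simp

variable [Fintype α] [Fintype β]

theorem sum_count (s : Fin n → α) : ∑ a, count s a = n := by
  have := Finset.card_eq_sum_card_fiberwise (f := s) (s := univ) (t := univ) (by simp)
  simpa [count] using this.symm

theorem count_le (s : Fin n → α) (a : α) : count s a ≤ n := by
  conv_rhs => rw [← sum_count s]
  exact Finset.single_le_sum (f := count s) (fun _ _ => Nat.zero_le _) (mem_univ a)

theorem card_perm_fixing (s : Fin n → α) :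
    (univ.filter fun g : Equiv.Perm (Fin n) => s ∘ g = s).card = ∏ a, (count s a).factorial := by
  rw [← Fintype.card_subtype, DomMulAct.stabilizer_card]
  simp only [count_eq_card]

theorem prod_apply_eq_prod_pow_count {M : Type*} [CommMonoid M] (s : Fin n → α) (f : α → M) :
    ∏ i, f (s i) = ∏ a, f a ^ count s a := by
  rw [← Finset.prod_fiberwise (s := univ) (g := s)]
  refine prod_congr rfl fun a _ => ?_
  rw [prod_congr rfl (g := fun _ => f a)]
  · simp [count]
  · intro i hi
    rw [(mem_filter.1 hi).2]

theorem sum_apply_eq_sum_count (s : Fin n → α) (f : α → ℝ) :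
    ∑ i, f (s i) = ∑ a, count s a * f a := by
  rw [← Finset.sum_fiberwise (s := univ) (g := s)]
  refine sum_congr rfl fun a _ => ?_
  rw [sum_congr rfl (g := fun _ => f a)]
  · simp [count]
  · intro i hi
    rw [(mem_filter.1 hi).2]

/-- Orbit-stabilizer: the permutations fixing `u` act transitively on the conditional class of `w`,
and the fibres of `g ↦ w ∘ g` are cosets of the permutations fixing both `u` and `w`. Both
stabilizers have sizes given by `card_perm_fixing`. -/
theorem card_condClass_mul (u : Fin n → α) (w : Fin n → β) :
    (univ.filter fun w' : Fin n → β =>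
        ∀ p, count (pairSeq u w') p = count (pairSeq u w) p).card *
      ∏ p, (count (pairSeq u w) p).factorial = ∏ a, (count u a).factorial := by
  classical
  rw [← card_perm_fixing u, ← card_perm_fixing (pairSeq u w)]
  have hmaps : ∀ g ∈ univ.filter (fun g : Equiv.Perm (Fin n) => u ∘ g = u),
      w ∘ g ∈ univ.filter fun w' : Fin n → β =>
        ∀ p, count (pairSeq u w') p = count (pairSeq u w) p := by
    intro g hg
    simp only [mem_filter, mem_univ, true_and] at hg ⊢
    intro p
    rw [← count_comp_perm (pairSeq u w) g]
    congr 1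
    funext i
    exact Prod.ext (congrFun hg i).symm rfl
  rw [Finset.card_eq_sum_card_fiberwise (f := fun g : Equiv.Perm (Fin n) => w ∘ g) hmaps,
    ← smul_eq_mul, ← Finset.sum_const]
  refine sum_congr rfl fun w' hw' => ?_
  simp only [mem_filter, mem_univ, true_and] at hw'
  obtain ⟨g₀, hg₀⟩ := exists_perm_of_count_eq fun p => (hw' p).symm
  have hu : ∀ i, u (g₀ i) = u i := fun i => congrArg Prod.fst (congrFun hg₀ i)
  have hw : ∀ i, w (g₀ i) = w' i := fun i => congrArg Prod.snd (congrFun hg₀ i)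
  refine Finset.card_bij (fun g _ => g * g₀) ?_ ?_ ?_
  · intro g hg
    simp only [mem_filter, mem_univ, true_and] at hg ⊢
    have h1 : ∀ i, u (g i) = u i := fun i => congrArg Prod.fst (congrFun hg i)
    have h2 : ∀ i, w (g i) = w i := fun i => congrArg Prod.snd (congrFun hg i)
    exact ⟨funext fun i => by simp [h1, hu], funext fun i => by simp [h2, hw]⟩
  · intro g _ g' _ h
    exact mul_right_cancel h
  · intro g hg
    simp only [mem_filter, mem_univ, true_and] at hg
    refine ⟨g * g₀⁻¹, ?_, by simp⟩
    simp only [mem_filter, mem_univ, true_and]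
    funext i
    have h1 := congrFun hg.1 (g₀⁻¹ i)
    have h2 := congrFun hg.2 (g₀⁻¹ i)
    have h3 := hu (g₀⁻¹ i)
    have h4 := hw (g₀⁻¹ i)
    have h5 : g₀ (g₀⁻¹ i) = i := g₀.apply_symm_apply i
    simp only [Function.comp, h5] at h1 h2 h3 h4
    refine Prod.ext ?_ ?_
    · simp only [pairSeq, Function.comp, Equiv.Perm.mul_apply]
      rw [h1, h3]
    · simp only [pairSeq, Function.comp, Equiv.Perm.mul_apply]
      rw [h2, h4]

/-- Passing from `k` to `k + 1` multiplies the left side by `N / (k + 1)`, which is at least `1`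
below `N` and at most `1` from `N` on. -/
theorem pow_div_factorial_le (N k : ℕ) :
    (N : ℝ) ^ k / k.factorial ≤ (N : ℝ) ^ N / N.factorial := by
  rcases le_total N k with h | h
  · induction k, h using Nat.le_induction with
    | base => exact le_rfl
    | succ k hk ih =>
      refine le_trans ?_ ih
      rw [pow_succ, Nat.factorial_succ, Nat.cast_mul, mul_comm ((k + 1 : ℕ) : ℝ), mul_div_mul_comm]
      refine mul_le_of_le_one_right (by positivity) ?_
      rw [div_le_one (by positivity)]
      exact_mod_cast hk.trans (Nat.le_succ k)
  · induction h using Nat.decreasingInduction with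
    | self => exact le_rfl
    | of_succ k hk ih =>
      refine le_trans ?_ ih
      rw [pow_succ, Nat.factorial_succ, Nat.cast_mul, mul_comm ((k + 1 : ℕ) : ℝ), mul_div_mul_comm]
      refine le_mul_of_one_le_right (by positivity) ?_
      rw [one_le_div (by positivity)]
      exact_mod_cast hk

/-- The conditional type class of `w` given `u` has probability at least `(n+1)^(-|α||β|)` under
the conditional type of `w` given `u`. -/
theorem one_le_prob_condClass (u : Fin n → α) (w : Fin n → β) :
    (1 : ℝ) ≤ ((n : ℝ) + 1) ^ (Fintype.card α * Fintype.card β) *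
      ((univ.filter fun w' : Fin n → β =>
        ∀ p, count (pairSeq u w') p = count (pairSeq u w) p).card *
      ∏ p : α × β, ((count (pairSeq u w) p : ℝ) / count u p.1) ^ count (pairSeq u w) p) := by
  classical
  set N := count (pairSeq u w) with hN
  set T : (Fin n → β) → ℝ := fun v => (univ.filter fun w' : Fin n → β =>
        ∀ p, count (pairSeq u w') p = count (pairSeq u v) p).card *
      ∏ p : α × β, ((N p : ℝ) / count u p.1) ^ count (pairSeq u v) p with hT
  -- `T v` is the probability of the conditional class of `v` under the conditional type of `w`. Up
  -- to a factor independent of `v` it is a product of terms `N^k / k!`, each maximal at `k = N`.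
  have hTle : ∀ v, T v ≤ T w := by
    have hform : ∀ v, T v = (∏ a, ((count u a).factorial : ℝ) / (count u a : ℝ) ^ count u a) *
        ∏ p : α × β, (N p : ℝ) ^ count (pairSeq u v) p / (count (pairSeq u v) p).factorial := by
      intro v
      have h1 := card_condClass_mul u v
      have h2 : (∏ p : α × β, (count u p.1 : ℝ) ^ count (pairSeq u v) p) =
          ∏ a, (count u a : ℝ) ^ count u a := by
        rw [Fintype.prod_prod_type]
        refine prod_congr rfl fun a _ => ?_
        simp only
        rw [Finset.prod_pow_eq_pow_sum, sum_count_pairSeq]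
      have h3 : (∏ p : α × β, ((count (pairSeq u v) p).factorial : ℝ)) ≠ 0 :=
        prod_ne_zero_iff.2 fun p _ => by positivity
      have h1' : ((univ.filter fun w' : Fin n → β =>
          ∀ p, count (pairSeq u w') p = count (pairSeq u v) p).card : ℝ) *
          ∏ p, ((count (pairSeq u v) p).factorial : ℝ) = ∏ a, ((count u a).factorial : ℝ) := by
        exact_mod_cast h1
      simp only [hT, div_pow, prod_div_distrib]
      rw [h2, ← h1']
      field_simp
    intro v
    rw [hform, hform]
    refine mul_le_mul_of_nonneg_left ?_ (prod_nonneg fun a _ => by positivity)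
    exact prod_le_prod (fun p _ => by positivity) fun p _ => pow_div_factorial_le _ _
  have hT0 : 0 ≤ T w := by
    simp only [hT]
    exact mul_nonneg (by positivity) (prod_nonneg fun p _ => by positivity)
  have hone : (1 : ℝ) = ∑ v : Fin n → β,
      ∏ p : α × β, ((N p : ℝ) / count u p.1) ^ count (pairSeq u v) p := by
    have h1 : ∀ i, ∑ b, (N (u i, b) : ℝ) / count u (u i) = 1 := by
      intro i
      rw [← sum_div, ← Nat.cast_sum, hN, sum_count_pairSeq, div_self]
      exact_mod_cast (count_pos_apply u i).ne'
    have h2 : ∏ i, ∑ b, (N (u i, b) : ℝ) / count u (u i) = 1 := prod_eq_one fun i _ => h1 i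
    rw [← h2, prod_univ_sum, Fintype.piFinset_univ]
    refine sum_congr rfl fun v _ => ?_
    rw [← prod_apply_eq_prod_pow_count (pairSeq u v) fun p => (N p : ℝ) / count u p.1]
    rfl
  -- The fibres of `F` are the conditional classes. They number at most `(n+1)^(|α||β|)`, have total
  -- probability `1`, and none exceeds that of `w`.
  let F : (Fin n → β) → (α × β → Fin (n + 1)) := fun v p =>
    ⟨count (pairSeq u v) p, Nat.lt_succ_of_le (count_le _ _)⟩
  have hF : ∀ v v', F v = F v' ↔ ∀ p, count (pairSeq u v) p = count (pairSeq u v') p := by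
    intro v v'
    simp only [F, funext_iff, Fin.mk.injEq]
  calc (1 : ℝ) = ∑ M, ∑ v ∈ univ.filter (fun v => F v = M),
        ∏ p : α × β, ((N p : ℝ) / count u p.1) ^ count (pairSeq u v) p := by
          rw [Finset.sum_fiberwise]; exact hone
    _ ≤ ∑ _M : α × β → Fin (n + 1), T w := by
        refine sum_le_sum fun M _ => ?_
        rcases (univ.filter fun v => F v = M).eq_empty_or_nonempty with h | ⟨v₀, hv₀⟩
        · rw [h, sum_empty]; exact hT0
        · have hM : F v₀ = M := (mem_filter.1 hv₀).2
          refine le_trans (le_of_eq ?_) (hTle v₀)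
          simp only [hT, ← hM, hF]
          rw [← nsmul_eq_mul, ← sum_const]
          refine sum_congr rfl fun v hv => prod_congr rfl fun p _ => ?_
          rw [(mem_filter.1 hv).2 p]
    _ = _ := by
        rw [sum_const, nsmul_eq_mul, card_univ]
        simp only [hT, hN, Fintype.card_pi, Fintype.card_fin, prod_const, card_univ, Fintype.card_prod]
        push_cast
        rfl

end Counting

-- Greedy covering and covering by product laws.

section Covering

/-- Greedy covering: `k` steps leave at most a fraction `(1 - p)^k` uncovered. -/
theorem exists_partial_cover {A Z : Type*} [Fintype Z] (good : A → Z → Prop) {μ : Z → ℝ}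
    (hμ : ∀ z, 0 ≤ μ z) (hμ1 : ∑ z, μ z ≤ 1) {p : ℝ} (hp0 : 0 < p) (hp1 : p ≤ 1) (S : Finset A)
    (hp : ∀ a ∈ S, ∃ G : Finset Z, (∀ z ∈ G, good a z) ∧ p ≤ ∑ z ∈ G, μ z) (k : ℕ) :
    ∃ (C : Finset Z) (S' : Finset A), C.card ≤ k ∧ (S'.card : ℝ) ≤ (1 - p) ^ k * S.card ∧
      S' ⊆ S ∧ ∀ a ∈ S, a ∈ S' ∨ ∃ z ∈ C, good a z := by
  classical
  induction k with
  | zero => exact ⟨∅, S, by simp, by simp, subset_rfl, fun a ha => Or.inl ha⟩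
  | succ k ih =>
    obtain ⟨C, S', hC, hS', hsub, hcov⟩ := ih
    rcases S'.eq_empty_or_nonempty with hS0 | ⟨a₀, ha₀⟩
    · have : 0 ≤ 1 - p := by linarith
      exact ⟨C, S', hC.trans (Nat.le_succ k), by
        rw [hS0, card_empty, Nat.cast_zero]; positivity, hsub, hcov⟩
    -- Double counting: this is the `μ`-average over `z` of the number of still uncovered targets
    -- that `z` serves.
    have hsum : p * S'.card ≤ ∑ z, μ z * (S'.filter fun a => good a z).card := by
      have : ∀ a ∈ S', p ≤ ∑ z, if good a z then μ z else 0 := by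
        intro a ha
        obtain ⟨G, hG, hpG⟩ := hp a (hsub ha)
        refine hpG.trans ?_
        rw [← sum_filter]
        exact sum_le_sum_of_subset_of_nonneg (fun z hz => by simp [hG z hz]) fun z _ _ => hμ z
      calc p * S'.card = ∑ a ∈ S', p := by simp [mul_comm]
        _ ≤ ∑ a ∈ S', ∑ z, if good a z then μ z else 0 := sum_le_sum this
        _ = ∑ z, ∑ a ∈ S', if good a z then μ z else 0 := sum_comm
        _ = _ := by
          refine sum_congr rfl fun z _ => ?_
          rw [← sum_filter, sum_const, nsmul_eq_mul, mul_comm]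
    obtain ⟨z, hz⟩ : ∃ z, p * S'.card ≤ ((S'.filter fun a => good a z).card : ℝ) := by
      by_contra! hcon
      obtain ⟨G, _, hpG⟩ := hp a₀ (hsub ha₀)
      -- A point of positive mass makes the comparison of averages strict.
      obtain ⟨z₀, hz₀⟩ : ∃ z, 0 < μ z := by
        by_contra! hz
        have : ∑ z ∈ G, μ z ≤ 0 := sum_nonpos fun z _ => hz z
        linarith
      have : ∑ z, μ z * (S'.filter fun a => good a z).card < ∑ z, μ z * (p * S'.card) :=
        sum_lt_sum (fun z _ => mul_le_mul_of_nonneg_left (hcon z).le (hμ z))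
          ⟨z₀, mem_univ _, mul_lt_mul_of_pos_left (hcon z₀) hz₀⟩
      rw [← sum_mul] at this
      have h3 : (∑ z, μ z) * (p * S'.card) ≤ 1 * (p * S'.card) :=
        mul_le_mul_of_nonneg_right hμ1 (by positivity)
      linarith
    refine ⟨insert z C, S'.filter fun a => ¬ good a z, (card_insert_le _ _).trans (by omega), ?_,
      (filter_subset _ _).trans hsub, ?_⟩
    · have h1 : ((S'.filter fun a => good a z).card : ℝ) +
          (S'.filter fun a => ¬ good a z).card = S'.card := by
        exact_mod_cast Finset.card_filter_add_card_filter_not (s := S') _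
      rw [pow_succ]
      have h2 : (1 - p) * (S'.card : ℝ) ≤ (1 - p) * ((1 - p) ^ k * S.card) :=
        mul_le_mul_of_nonneg_left hS' (by linarith)
      linarith
    · intro a ha
      rcases hcov a ha with h | ⟨c, hc, hg⟩
      · by_cases hgz : good a z
        · exact Or.inr ⟨z, mem_insert_self _ _, hgz⟩
        · exact Or.inl (mem_filter.2 ⟨h, hgz⟩)
      · exact Or.inr ⟨c, mem_insert_of_mem hc, hg⟩

/-- After `k > log |S| / p` greedy steps fewer than `exp(-p k) |S| < 1` targets remain, hence none.
Rounding `k` up to an integer is paid for by `1 ≤ 1 / p`. -/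
theorem exists_cover {A Z : Type*} [Fintype Z] (good : A → Z → Prop) {μ : Z → ℝ}
    (hμ : ∀ z, 0 ≤ μ z) (hμ1 : ∑ z, μ z ≤ 1) {p : ℝ} (hp0 : 0 < p) (S : Finset A)
    (hp : ∀ a ∈ S, ∃ G : Finset Z, (∀ z ∈ G, good a z) ∧ p ≤ ∑ z ∈ G, μ z) :
    ∃ C : Finset Z, (∀ a ∈ S, ∃ z ∈ C, good a z) ∧
      (C.card : ℝ) ≤ (Real.log S.card + 1) / p := by
  rcases S.eq_empty_or_nonempty with rfl | hS
  · exact ⟨∅, by simp, by simp [hp0.le]⟩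
  have hp1 : p ≤ 1 := by
    obtain ⟨a, ha⟩ := hS
    obtain ⟨G, _, hG⟩ := hp a ha
    exact hG.trans ((sum_le_univ_sum_of_nonneg hμ).trans hμ1)
  have hcard : (1 : ℝ) ≤ S.card := by exact_mod_cast hS.card_pos
  have hlog : 0 ≤ Real.log S.card := Real.log_nonneg hcard
  obtain ⟨C, S', hC, hS', -, hcov⟩ :=
    exists_partial_cover good hμ hμ1 hp0 hp1 S hp (⌊Real.log S.card / p⌋₊ + 1)
  have hk := Nat.lt_floor_add_one (Real.log S.card / p)
  have hS0 : S' = ∅ := by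
    rw [← card_eq_zero, ← Nat.lt_one_iff]
    have h1 : (1 - p) ^ (⌊Real.log S.card / p⌋₊ + 1) ≤
        Real.exp (-(p * (⌊Real.log S.card / p⌋₊ + 1))) := by
      refine (pow_le_pow_left₀ (by linarith) (Real.one_sub_le_exp_neg p) _).trans (le_of_eq ?_)
      rw [← Real.exp_nat_mul]
      push_cast
      ring_nf
    have h2 : Real.exp (-(p * (⌊Real.log S.card / p⌋₊ + 1))) < (S.card : ℝ)⁻¹ := by
      rw [← Real.exp_log (inv_pos.2 (zero_lt_one.trans_le hcard)), Real.exp_lt_exp, Real.log_inv]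
      rw [div_lt_iff₀ hp0] at hk
      linarith
    have h3 : (S'.card : ℝ) < 1 := by
      refine hS'.trans_lt ?_
      calc _ < (S.card : ℝ)⁻¹ * S.card :=
            mul_lt_mul_of_pos_right (h1.trans_lt h2) (zero_lt_one.trans_le hcard)
        _ = 1 := inv_mul_cancel₀ (by linarith)
    exact_mod_cast h3
  refine ⟨C, fun a ha => (hcov a ha).resolve_left (by simp [hS0]), ?_⟩
  calc (C.card : ℝ) ≤ ((⌊Real.log S.card / p⌋₊ + 1 : ℕ) : ℝ) := by exact_mod_cast hC
    _ ≤ Real.log S.card / p + 1 := by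
        push_cast
        have := Nat.floor_le (div_nonneg hlog hp0.le)
        linarith
    _ ≤ (Real.log S.card + 1) / p := by
        rw [add_div]
        have := (one_le_div hp0).2 hp1
        linarith

/-- Type covering with sampling letterwise from `R`, whose divergence from the conditional type
with counts `N` is at most `E`. -/
theorem exists_type_cover {α β : Type*} [Fintype α] [DecidableEq α] [Fintype β] [DecidableEq β]
    {n : ℕ} (A : Finset (Fin n → α)) (M : α → ℕ) (N : α × β → ℕ)
    (hA : ∀ u ∈ A, ∀ a, count u a = M a) (hN : ∀ a, ∑ b, N (a, b) = M a)
    (ρ : Fin n → β → ℝ) (hρ : ∀ i, ρ i ∈ stdSimplex ℝ β) (R : α × β → ℝ)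
    (hR : ∀ u ∈ A, ∀ i b, ρ i b = R (u i, b)) (hR0 : ∀ p, 0 < N p → 0 < R p) (E : ℝ)
    (hE : ∑ p : α × β, N p * Real.log (N p / (M p.1 * R p)) ≤ E) :
    ∃ C : Finset (Fin n → β), (∀ u ∈ A, ∃ z ∈ C, ∀ p, count (pairSeq u z) p = N p) ∧
      (C.card : ℝ) ≤ (Real.log A.card + 1) *
        (((n : ℝ) + 1) ^ (Fintype.card α * Fintype.card β) * Real.exp E) := by
  classical
  set K := ((n : ℝ) + 1) ^ (Fintype.card α * Fintype.card β)
  have hK : 0 < K := by positivity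
  have := exists_cover (fun (u : Fin n → α) (z : Fin n → β) => ∀ p, count (pairSeq u z) p = N p)
    (μ := fun z => ∏ i, ρ i (z i)) (fun z => prod_nonneg fun i _ => (hρ i).1 _)
    (by
      have h := (prod_univ_sum (fun _ : Fin n => (univ : Finset β)) ρ).symm
      rw [Fintype.piFinset_univ] at h
      rw [h]
      exact (prod_eq_one fun i _ => (hρ i).2).le)
    (p := (K * Real.exp E)⁻¹) (by positivity) A ?_
  · simpa only [div_inv_eq_mul] using this
  intro u hu
  obtain ⟨w, hw⟩ := exists_count_pairSeq_eq u N fun a => (hN a).trans (hA u hu a).symm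
  refine ⟨univ.filter fun z => ∀ p, count (pairSeq u z) p = N p, by simp, ?_⟩
  have h1 := one_le_prob_condClass u w
  simp only [hw, hA u hu] at h1
  -- Change of measure: passing from the conditional type to the sampling law `R` costs the
  -- exponential of the divergence.
  have h2 : ∏ p : α × β, ((N p : ℝ) / M p.1) ^ N p ≤
      Real.exp E * ∏ p : α × β, R p ^ N p := by
    have hprod : 0 ≤ ∏ p : α × β, R p ^ N p := prod_nonneg fun p _ => by
      rcases Nat.eq_zero_or_pos (N p) with h | h
      · simp [h]
      · exact pow_nonneg (hR0 p h).le _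
    refine le_trans (le_of_eq ?_) (mul_le_mul_of_nonneg_right (Real.exp_le_exp.2 hE) hprod)
    rw [Real.exp_sum, ← prod_mul_distrib]
    refine prod_congr rfl fun p _ => ?_
    rcases Nat.eq_zero_or_pos (N p) with h | h
    · simp [h]
    · have hM : N p ≤ M p.1 := by
        rw [← hN]
        exact single_le_sum (f := fun b => N (p.1, b)) (fun _ _ => Nat.zero_le _) (mem_univ p.2)
      have hN0 : (0 : ℝ) < N p := by exact_mod_cast h
      have hM0 : (0 : ℝ) < M p.1 := by exact_mod_cast h.trans_le hM
      have hRp := hR0 p h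
      rw [Real.exp_nat_mul, Real.exp_log (by positivity), ← mul_pow]
      congr 1
      field_simp
  have h3 : ∀ z ∈ univ.filter fun z : Fin n → β => ∀ p, count (pairSeq u z) p = N p,
      ∏ i, ρ i (z i) = ∏ p : α × β, R p ^ N p := by
    intro z hz
    simp only [mem_filter, mem_univ, true_and] at hz
    rw [prod_congr rfl fun i _ => hR u hu i (z i)]
    rw [← prod_congr rfl fun p _ => congrArg (R p ^ ·) (hz p), ← prod_apply_eq_prod_pow_count]
    rfl
  rw [sum_congr rfl h3, sum_const, nsmul_eq_mul, inv_le_iff_one_le_mul₀ (by positivity)]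
  calc (1 : ℝ) ≤ _ := h1
    _ ≤ K * (_ * (Real.exp E * ∏ p : α × β, R p ^ N p)) :=
        mul_le_mul_of_nonneg_left (mul_le_mul_of_nonneg_left h2 (by positivity)) hK.le
    _ = _ := by ring

end Covering

-- Modulus of continuity of `-x log x` at scale `1/n`.

section EntropyContinuity

theorem negMulLog_le_tangent {x a : ℝ} (hx : 0 ≤ x) (ha : 0 < a) :
    Real.negMulLog x ≤ x * Real.log a⁻¹ + a - x := by
  rcases hx.eq_or_lt with rfl | hx
  · simpa using ha.le
  have h := Real.log_le_sub_one_of_pos (div_pos ha hx)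
  rw [Real.log_div ha.ne' hx.ne'] at h
  have h2 := mul_le_mul_of_nonneg_left h hx.le
  rw [mul_sub, mul_sub, mul_div_cancel₀ _ hx.ne'] at h2
  rw [Real.negMulLog, Real.log_inv]
  linarith

theorem negMulLog_le_log_succ_div {x : ℝ} {n : ℕ} (hn : 1 ≤ n) (hx : 0 ≤ x) (hxn : x ≤ 1 / n) :
    Real.negMulLog x ≤ Real.log (n + 1) / n := by
  have h := negMulLog_le_tangent hx (a := ((n : ℝ) + 1)⁻¹) (by positivity)
  rw [inv_inv] at h
  rcases hn.eq_or_lt with rfl | hn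
  · have := Real.log_two_gt_d9
    have := Real.log_two_lt_d9
    norm_num at h hxn ⊢
    nlinarith
  · have hn' : (2 : ℝ) ≤ n := by exact_mod_cast hn
    have hlog : 1 ≤ Real.log (n + 1) := by
      rw [Real.le_log_iff_exp_le (by positivity)]
      linarith [Real.exp_one_lt_d9]
    have h1 : x * (Real.log (n + 1) - 1) ≤ 1 / n * (Real.log (n + 1) - 1) :=
      mul_le_mul_of_nonneg_right hxn (by linarith)
    have h2 : ((n : ℝ) + 1)⁻¹ ≤ 1 / n := by
      rw [one_div]; exact inv_anti₀ (by linarith) (by linarith)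
    rw [div_eq_mul_one_div, mul_comm]
    linarith

theorem negMulLog_sub_le_negMulLog {s t : ℝ} (hs : 0 ≤ s) (hst : s ≤ t) :
    Real.negMulLog t - Real.negMulLog s ≤ Real.negMulLog (t - s) := by
  have key : ∀ r, 0 ≤ r → r ≤ t → r * Real.log r ≤ r * Real.log t := by
    intro r hr hrt
    rcases hr.eq_or_lt with rfl | hr
    · simp
    · exact mul_le_mul_of_nonneg_left (Real.log_le_log hr hrt) hr.le
  have h1 := key s hs hst
  have h2 := key (t - s) (by linarith) (by linarith)
  simp only [Real.negMulLog]
  linarith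

theorem negMulLog_sub_le_sub {s t : ℝ} (hs : 0 ≤ s) (hst : s ≤ t) (ht : t ≤ 1) :
    Real.negMulLog s - Real.negMulLog t ≤ t - s := by
  rcases hst.eq_or_lt with rfl | hst
  · simp
  have ht0 : 0 < t := hs.trans_lt hst
  have h := negMulLog_le_tangent hs ht0
  have h1 : (t - s) * Real.log t ≤ 0 :=
    mul_nonpos_of_nonneg_of_nonpos (by linarith) (Real.log_nonpos ht0.le ht)
  rw [Real.log_inv] at h
  have : Real.negMulLog t = -t * Real.log t := rfl
  linarith

/-- An increase is controlled by subadditivity of `-x log x`, a decrease by its slope being at least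
`-1` on `[0, 1]`. The case `n = 1` is separate because `log 2 < 1`; there the bound `-x log x ≤ log
2` suffices. -/
theorem abs_negMulLog_sub_le {s t : ℝ} {n : ℕ} (hn : 1 ≤ n) (hs : 0 ≤ s) (hs1 : s ≤ 1)
    (ht : 0 ≤ t) (ht1 : t ≤ 1) (hst : |s - t| ≤ 1 / n) :
    |Real.negMulLog s - Real.negMulLog t| ≤ Real.log (n + 1) / n := by
  wlog h : s ≤ t generalizing s t
  · rw [abs_sub_comm] at hst ⊢
    exact this ht ht1 hs hs1 hst (le_of_not_ge h)
  rw [abs_sub_comm, abs_of_nonneg (by linarith)] at hst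
  rw [abs_le]
  constructor
  · have h1 := negMulLog_sub_le_negMulLog hs h
    have h2 := negMulLog_le_log_succ_div hn (by linarith) hst
    linarith
  · rcases hn.eq_or_lt with rfl | hn
    · have h1 := negMulLog_le_log_succ_div le_rfl hs (by simpa using hs1)
      linarith [Real.negMulLog_nonneg ht ht1]
    · have hn' : (2 : ℝ) ≤ n := by exact_mod_cast hn
      have hlog : 1 ≤ Real.log (n + 1) := by
        rw [Real.le_log_iff_exp_le (by positivity)]
        linarith [Real.exp_one_lt_d9]
      have h2 : 1 / (n : ℝ) ≤ Real.log (n + 1) / n :=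
        div_le_div_of_nonneg_right hlog (by positivity)
      linarith [negMulLog_sub_le_sub hs h ht1]

theorem abs_negMulLog_sub_le_mul {n : ℕ} (hn : 1 ≤ n) (m : ℕ) {s t : ℝ} (hs : 0 ≤ s)
    (hs1 : s ≤ 1) (ht : 0 ≤ t) (ht1 : t ≤ 1) (hst : |s - t| ≤ m * (1 / n)) :
    |Real.negMulLog s - Real.negMulLog t| ≤ m * (Real.log (n + 1) / n) := by
  induction m generalizing s with
  | zero =>
    have : s - t = 0 := by simpa using hst
    rw [sub_eq_zero.1 this]
    simp
  | succ m ih =>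
    have hm : (0 : ℝ) < m + 1 := by positivity
    -- The segment from `s` to `t` is cut into `m + 1` equal pieces and `r` ends the first one.
    set r := (m * s + t) / (m + 1) with hr
    have hr0 : 0 ≤ r := by positivity
    have hr1 : r ≤ 1 := by
      rw [hr, div_le_one hm]
      nlinarith [Nat.cast_nonneg (α := ℝ) m]
    have h1 : s - r = (s - t) / (m + 1) := by rw [hr]; field_simp; ring
    have h2 : r - t = (s - t) / (m + 1) * m := by rw [hr]; field_simp; ring
    have h3 : |(s - t) / (m + 1)| ≤ 1 / n := by
      rw [abs_div, abs_of_pos hm, div_le_iff₀ hm]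
      push_cast at hst
      linarith
    have h4 := abs_negMulLog_sub_le hn hs hs1 hr0 hr1 (by rwa [h1])
    have h5 := ih hr0 hr1 (by
      rw [h2, abs_mul, Nat.abs_cast, mul_comm]
      exact mul_le_mul_of_nonneg_left h3 (by positivity))
    have h6 := abs_sub_le (Real.negMulLog s) (Real.negMulLog r) (Real.negMulLog t)
    push_cast
    linarith

end EntropyContinuity

-- Mutual information through entropies, and its continuity.

section MutualInformation

variable {α β : Type*} [Fintype α] [Fintype β]

theorem outputDist_mem_stdSimplex {P : α → ℝ} {V : α → β → ℝ} (hP : P ∈ stdSimplex ℝ α)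
    (hV : IsChannel V) : outputDist P V ∈ stdSimplex ℝ β := by
  refine ⟨fun b => sum_nonneg fun a _ => mul_nonneg (hP.1 a) ((hV a).1 b), ?_⟩
  simp only [outputDist]
  rw [sum_comm]
  simp only [← mul_sum, (hV _).2, mul_one, hP.2]

theorem mutualInfo_mul_log_two {P : α → ℝ} {V : α → β → ℝ} (hP : ∀ a, 0 ≤ P a)
    (hV : IsChannel V) :
    mutualInfo P V * Real.log 2 = ∑ b, Real.negMulLog (outputDist P V b) -
      ∑ a, ∑ b, Real.negMulLog (P a * V a b) + ∑ a, Real.negMulLog (P a) := by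
  have hterm : ∀ a b, P a * V a b * Real.logb 2 (V a b / outputDist P V b) * Real.log 2 =
      -(P a * V a b * Real.log (outputDist P V b)) - Real.negMulLog (P a * V a b) -
        P a * V a b * Real.log (P a) := by
    intro a b
    have hnn := mul_nonneg (hP a) ((hV a).1 b)
    rcases hnn.eq_or_lt with h | h
    · simp [← h]
    · have hPa : 0 < P a := (hP a).lt_of_ne fun h0 => by simp [← h0] at h
      have hVa : 0 < V a b := ((hV a).1 b).lt_of_ne fun h0 => by simp [← h0] at h
      have hout : 0 < outputDist P V b := h.trans_le
        (single_le_sum (f := fun a => P a * V a b)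
          (fun a _ => mul_nonneg (hP a) ((hV a).1 b)) (mem_univ a))
      rw [Real.logb, mul_assoc, div_mul_cancel₀ _ (Real.log_pos one_lt_two).ne',
        Real.log_div hVa.ne' hout.ne', Real.negMulLog, Real.log_mul hPa.ne' hVa.ne']
      ring
  have h1 : ∑ a, ∑ b, P a * V a b * Real.log (outputDist P V b) =
      ∑ b, outputDist P V b * Real.log (outputDist P V b) := by
    rw [sum_comm]
    simp only [outputDist, sum_mul]
  have h2 : ∀ a, ∑ b, P a * V a b * Real.log (P a) = P a * Real.log (P a) := by
    intro a
    rw [← sum_mul, ← mul_sum, (hV a).2, mul_one]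
  simp only [mutualInfo, sum_mul, hterm, sum_sub_distrib, sum_neg_distrib, h1, h2]
  simp only [Real.negMulLog, neg_mul, sum_neg_distrib]
  ring

theorem le_one_of_mem_stdSimplex {p : α → ℝ} (hp : p ∈ stdSimplex ℝ α) (a : α) : p a ≤ 1 := by
  rw [← hp.2]
  exact single_le_sum (fun a _ => hp.1 a) (mem_univ a)

/-- The input entropy is common to both sides. Each of the `|α||β|` joint probabilities costs
`log(n+1)/n`, and each of the `|β|` output probabilities, a sum of `|α|` of them, costs `|α|` times
as much. -/
theorem mutualInfo_le_of_near {n : ℕ} (hn : 1 ≤ n) {P : α → ℝ} {V U : α → β → ℝ}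
    (hP : P ∈ stdSimplex ℝ α) (hV : IsChannel V) (hU : IsChannel U)
    (h : ∀ a b, |P a * V a b - P a * U a b| ≤ 1 / n) :
    mutualInfo P V ≤ mutualInfo P U +
      2 * (Fintype.card α * Fintype.card β) * (Real.logb 2 (n + 1) / n) := by
  have hlog2 := Real.log_pos one_lt_two
  have hjoint : ∀ {T : α → β → ℝ}, IsChannel T → ∀ a b, 0 ≤ P a * T a b ∧ P a * T a b ≤ 1 :=
    fun hT a b => ⟨mul_nonneg (hP.1 a) ((hT a).1 b),
      mul_le_one₀ (le_one_of_mem_stdSimplex hP a) ((hT a).1 b) (le_one_of_mem_stdSimplex (hT a) b)⟩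
  have h1 : ∀ a b, Real.negMulLog (P a * U a b) ≤
      Real.negMulLog (P a * V a b) + Real.log (n + 1) / n := by
    intro a b
    have := (abs_le.1 (abs_negMulLog_sub_le hn (hjoint hV a b).1 (hjoint hV a b).2
      (hjoint hU a b).1 (hjoint hU a b).2 (h a b))).1
    linarith
  have hoV := outputDist_mem_stdSimplex hP hV
  have hoU := outputDist_mem_stdSimplex hP hU
  have h2 : ∀ b, Real.negMulLog (outputDist P V b) ≤
      Real.negMulLog (outputDist P U b) + Fintype.card α * (Real.log (n + 1) / n) := by
    intro b
    have hd : |outputDist P V b - outputDist P U b| ≤ Fintype.card α * (1 / n) := by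
      simp only [outputDist, ← sum_sub_distrib]
      refine (abs_sum_le_sum_abs _ _).trans ((sum_le_sum fun a _ => h a b).trans ?_)
      simp
    have := (abs_le.1 (abs_negMulLog_sub_le_mul hn _ (hoV.1 b) (le_one_of_mem_stdSimplex hoV b)
      (hoU.1 b) (le_one_of_mem_stdSimplex hoU b) hd)).2
    linarith
  have h3 := sum_le_sum fun a (_ : a ∈ univ) => sum_le_sum fun b (_ : b ∈ univ) => h1 a b
  have h4 := sum_le_sum fun b (_ : b ∈ univ) => h2 b
  simp only [sum_add_distrib, sum_const, card_univ, nsmul_eq_mul] at h3 h4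
  refine le_of_mul_le_mul_right ?_ hlog2
  have h5 : Real.logb 2 (n + 1) / n * Real.log 2 = Real.log (n + 1) / n := by
    rw [Real.logb]; field_simp
  rw [add_mul, mul_assoc _ _ (Real.log 2), h5, mutualInfo_mul_log_two hP.1 hV,
    mutualInfo_mul_log_two hP.1 hU]
  linarith

end MutualInformation

-- Rounding to integers with a prescribed sum.

section Rounding

/-- Everything is rounded down; the deficit is at most the number of entries, so it can be made up
by adding one unit to each of a suitable subset. -/
theorem exists_nat_rounding {β : Type*} [Fintype β] {f : β → ℝ} (hf : ∀ b, 0 ≤ f b) {N : ℕ}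
    (hN : ∑ b, f b = N) : ∃ g : β → ℕ, ∑ b, g b = N ∧ ∀ b, |(g b : ℝ) - f b| ≤ 1 := by
  classical
  have h1 : ∑ b, ⌊f b⌋₊ ≤ N := by
    have : (∑ b, (⌊f b⌋₊ : ℝ)) ≤ N := hN ▸ sum_le_sum fun b _ => Nat.floor_le (hf b)
    exact_mod_cast this
  have h2 : N ≤ ∑ b, ⌊f b⌋₊ + Fintype.card β := by
    have : (N : ℝ) ≤ ∑ b, ((⌊f b⌋₊ : ℝ) + 1) :=
      hN ▸ sum_le_sum fun b _ => (Nat.lt_floor_add_one (f b)).le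
    rw [sum_add_distrib] at this
    simp only [sum_const, card_univ, nsmul_eq_mul, mul_one] at this
    exact_mod_cast this
  obtain ⟨S, -, hS⟩ := exists_subset_card_eq (s := (univ : Finset β)) (n := N - ∑ b, ⌊f b⌋₊)
    (by rw [card_univ]; omega)
  refine ⟨fun b => ⌊f b⌋₊ + if b ∈ S then 1 else 0, ?_, fun b => ?_⟩
  · rw [sum_add_distrib, sum_ite_mem, univ_inter, ← card_eq_sum_ones, hS]
    omega
  · have h3 := Nat.floor_le (hf b)
    have h4 := Nat.lt_floor_add_one (f b)
    rw [abs_le]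
    dsimp only
    split_ifs <;> push_cast <;> constructor <;> linarith

end Rounding

-- Rounding the test channel and building the common codebook.

section TypeCovering

variable {α β : Type*} [DecidableEq α] [DecidableEq β] {n : ℕ}

theorem empirical_apply (s : Fin n → α) (a : α) : empirical s a = (count s a : ℝ) / n := rfl

theorem sum_empirical_pairSeq_left [Fintype α] (u : Fin n → α) (w : Fin n → β) (b : β) :
    ∑ a, empirical (pairSeq u w) (a, b) = empirical w b := by
  have := Finset.card_eq_sum_card_fiberwise (f := u) (s := univ.filter fun i => w i = b)
    (t := univ) (by simp)
  simp only [empirical]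
  rw [this, Nat.cast_sum, sum_div]
  refine sum_congr rfl fun a _ => ?_
  rw [filter_filter]
  simp only [pairSeq, Prod.mk.injEq, and_comm]

theorem empirical_eq_iff (hn : 1 ≤ n) (s : Fin n → α) (N : α → ℕ) :
    (empirical s = fun a => (N a : ℝ) / n) ↔ ∀ a, count s a = N a := by
  have hn' : (n : ℝ) ≠ 0 := by positivity
  rw [funext_iff]
  refine forall_congr' fun a => ?_
  rw [empirical_apply, div_left_inj' hn', Nat.cast_inj]

variable [Fintype β]

/-- Rounding a channel to a conditional type. -/
theorem exists_condType_near (hn : 1 ≤ n) {Q : α → ℝ} (hQ : IsType n Q) {P : α → β → ℝ}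
    (hP : IsChannel P) :
    ∃ (V : α → β → ℝ) (M : α → ℕ) (N : α × β → ℕ), IsCondType n Q V ∧
      (∀ a b, |Q a * V a b - Q a * P a b| ≤ 1 / n) ∧ (∀ a, ∑ b, N (a, b) = M a) ∧
      (Q = fun a => (M a : ℝ) / n) ∧ (jointDist Q V = fun p => (N p : ℝ) / n) ∧
      ∀ a, 0 < M a → ∀ b, V a b = N (a, b) / M a := by
  obtain ⟨u₀, rfl⟩ := hQ
  have hn' : (0 : ℝ) < n := by positivity
  set M := count u₀
  choose g hg hgd using fun a => exists_nat_rounding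
    (f := fun b => (M a : ℝ) * P a b) (N := M a)
    (fun b => mul_nonneg (Nat.cast_nonneg _) ((hP a).1 b)) (by rw [← mul_sum, (hP a).2, mul_one])
  have hg0 : ∀ a, M a = 0 → ∀ b, g a b = 0 := by
    intro a ha b
    have := hg a
    rw [ha, sum_eq_zero_iff] at this
    exact this b (mem_univ b)
  -- On letters that do not occur the row is free; taking it from `P` keeps `V` a channel.
  let V : α → β → ℝ := fun a b => if M a = 0 then P a b else g a b / M a
  have hMV : ∀ a b, (M a : ℝ) * V a b = g a b := by
    intro a b
    by_cases h : M a = 0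
    · simp [h, hg0 a h b]
    · simp only [V, if_neg h]
      rw [mul_div_cancel₀]
      exact_mod_cast h
  have hjoint : ∀ u : Fin n → α, empirical u = empirical u₀ →
      jointDist (empirical u) V = fun p => (g p.1 p.2 : ℝ) / n := by
    intro u hu
    funext p
    rw [hu, jointDist, empirical_apply, ← hMV, div_mul_eq_mul_div]
  refine ⟨V, M, fun p => g p.1 p.2, ⟨fun a => ?_, fun u hu => ?_⟩, fun a b => ?_, hg, rfl,
    hjoint u₀ rfl, fun a ha b => if_neg ha.ne'⟩
  · by_cases h : M a = 0
    · simpa only [V, if_pos h] using hP a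
    · simp only [V, if_neg h]
      refine ⟨fun b => by positivity, ?_⟩
      rw [← sum_div, ← Nat.cast_sum, hg, div_self]
      exact_mod_cast h
  · have hcount : ∀ a, M a = count u a := fun a => ((empirical_eq_iff hn u M).1 hu a).symm
    obtain ⟨w, hw⟩ := exists_count_pairSeq_eq u (fun p => g p.1 p.2)
      fun a => (hg a).trans (hcount a)
    refine ⟨w, ?_⟩
    rw [condTypeClass, Set.mem_ofPred_eq, hjoint u hu, empirical_eq_iff hn]
    exact hw
  · have h1 : empirical u₀ a * V a b - empirical u₀ a * P a b = (g a b - M a * P a b) / n := by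
      rw [← hMV, empirical_apply]; ring
    rw [h1, abs_div, abs_of_pos hn']
    exact div_le_div_of_nonneg_right (hgd a b) hn'.le

variable [Fintype α]

theorem empirical_mem_stdSimplex (hn : 1 ≤ n) (s : Fin n → α) :
    empirical s ∈ stdSimplex ℝ α := by
  have hn' : (n : ℝ) ≠ 0 := by positivity
  refine ⟨fun a => div_nonneg (Nat.cast_nonneg _) (Nat.cast_nonneg _), ?_⟩
  simp only [empirical_apply]
  rw [← sum_div, ← Nat.cast_sum, sum_count, div_self hn']

/-- Natural logarithms gain the factor `log 2 < 0.7`, and the remaining `0.3 (n+1)^4 ≥ 0.3 · 16`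
absorbs the `1`. This bounds the factor `log |S| + 1` of the greedy cover. -/
theorem mul_log_card_add_one_le {c : ℝ} (hn : 1 ≤ n)
    (h : n * Real.logb 2 c < ((n : ℝ) + 1) ^ 4) :
    n * Real.log c + 1 ≤ ((n : ℝ) + 1) ^ 4 := by
  have hlog : Real.log c = Real.logb 2 c * Real.log 2 := by
    rw [Real.logb, div_mul_cancel₀ _ (Real.log_pos one_lt_two).ne']
  have h2 := Real.log_two_lt_d9
  have h3 := Real.log_two_gt_d9
  have hn' : (1 : ℝ) ≤ n := by exact_mod_cast hn
  have h4 : (2 : ℝ) ^ 4 ≤ ((n : ℝ) + 1) ^ 4 := pow_le_pow_left₀ (by norm_num) (by linarith) 4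
  have h5 : (n : ℝ) * Real.log c ≤ ((n : ℝ) + 1) ^ 4 * Real.log 2 := by
    rw [hlog, ← mul_assoc]
    exact mul_le_mul_of_nonneg_right h.le (by linarith)
  nlinarith

/-- Type covering: the sequences of type `Q` are covered, in a joint type close to `Q × P`, by
about `2^(n I(Q, P))` sequences. -/
theorem exists_condType_cover (hn : 1 ≤ n) {Q : α → ℝ} (hQ : IsType n Q) {P : α → β → ℝ}
    (hP : IsChannel P) (h : n * Real.logb 2 (Fintype.card α) < ((n : ℝ) + 1) ^ 4) :
    ∃ V : α → β → ℝ, IsCondType n Q V ∧ (∀ a b, |Q a * V a b - Q a * P a b| ≤ 1 / n) ∧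
      ∃ C : Finset (Fin n → β), (C : Set (Fin n → β)) ⊆ typeClass n (outputDist Q V) ∧
        (∀ u ∈ typeClass n Q, ∃ w ∈ C, pairSeq u w ∈ typeClass n (jointDist Q V)) ∧
        1 / (n : ℝ) * Real.logb 2 C.card ≤ mutualInfo Q P +
          (3 * (Fintype.card α * Fintype.card β) + 4) * (Real.logb 2 (n + 1) / n) := by
  classical
  have hn' : (0 : ℝ) < n := by positivity
  have hn1 : (1 : ℝ) ≤ n := by exact_mod_cast hn
  have hlog2 := Real.log_pos one_lt_two
  obtain ⟨V, M, N, hV, hnear, hN, hQM, hjoint, hVN⟩ := exists_condType_near hn hQ hP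
  have hQs : Q ∈ stdSimplex ℝ α := by
    obtain ⟨u₀, rfl⟩ := hQ
    exact empirical_mem_stdSimplex hn u₀
  have hout := outputDist_mem_stdSimplex hQs hV.1
  refine ⟨V, hV, hnear, ?_⟩
  have hjointp : ∀ a b, Q a * V a b = N (a, b) / n := fun a b => congrFun hjoint (a, b)
  have hterm : ∀ a b, (N (a, b) : ℝ) * Real.log (N (a, b) / (M a * outputDist Q V b)) =
      n * Real.log 2 * (Q a * V a b * Real.logb 2 (V a b / outputDist Q V b)) := by
    intro a b
    rw [hjointp]
    rcases Nat.eq_zero_or_pos (N (a, b)) with h0 | h0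
    · simp [h0]
    · have hM : 0 < M a := h0.trans_le (by
        rw [← hN]
        exact single_le_sum (f := fun b => N (a, b)) (fun _ _ => Nat.zero_le _) (mem_univ b))
      rw [hVN a hM b, div_div, Real.logb]
      field_simp
  obtain ⟨C, hC, hcard⟩ := exists_type_cover
    (univ.filter fun u : Fin n → α => ∀ a, count u a = M a) M N (by simp) hN
    (fun _ => outputDist Q V) (fun _ => hout) (fun p => outputDist Q V p.2)
    (fun _ _ _ _ => rfl)
    (by
      rintro ⟨a, b⟩ hp
      refine lt_of_lt_of_le ?_ (single_le_sum (f := fun a => Q a * V a b)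
        (fun a _ => mul_nonneg (hQs.1 a) ((hV.1 a).1 b)) (mem_univ a))
      rw [hjointp]
      have : (0 : ℝ) < N (a, b) := by exact_mod_cast hp
      positivity)
    (n * Real.log 2 * mutualInfo Q V)
    (by
      rw [Fintype.sum_prod_type]
      simp only [hterm, mutualInfo, mul_sum]
      exact le_rfl)
  -- Discarding codewords of the wrong type is harmless: a codeword that serves some `u` has the
  -- output type automatically.
  have hcover : ∀ u ∈ typeClass n Q, ∃ w ∈ C.filter fun w => w ∈ typeClass n (outputDist Q V),
      pairSeq u w ∈ typeClass n (jointDist Q V) := by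
    intro u hu
    have hu' := hu
    rw [typeClass, Set.mem_ofPred_eq, hQM, empirical_eq_iff hn] at hu'
    obtain ⟨w, hwC, hw⟩ := hC u (by simpa using hu')
    have hmem : pairSeq u w ∈ typeClass n (jointDist Q V) := by
      rw [typeClass, Set.mem_ofPred_eq, hjoint, empirical_eq_iff hn]
      exact hw
    refine ⟨w, mem_filter.2 ⟨hwC, ?_⟩, hmem⟩
    funext b
    rw [← sum_empirical_pairSeq_left u w b, hmem]
    rfl
  refine ⟨C.filter fun w => w ∈ typeClass n (outputDist Q V),
    fun w hw => (mem_filter.1 hw).2, hcover, ?_⟩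
  · set K := Fintype.card α * Fintype.card β with hK
    have hA : Real.log (univ.filter fun u : Fin n → α => ∀ a, count u a = M a).card + 1 ≤
        ((n : ℝ) + 1) ^ 4 := by
      obtain ⟨u₀, hu₀⟩ := hQ
      refine le_trans ?_ (mul_log_card_add_one_le hn h)
      rw [← Real.log_pow]
      have hpos : 0 < (univ.filter fun u : Fin n → α => ∀ a, count u a = M a).card := by
        refine card_pos.2 ⟨u₀, ?_⟩
        rw [hQM, empirical_eq_iff hn] at hu₀
        simpa using hu₀
      have hle : (univ.filter fun u : Fin n → α => ∀ a, count u a = M a).card ≤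
          Fintype.card α ^ n := by
        refine (card_le_univ _).trans ?_
        simp
      gcongr
      exact_mod_cast hle
    have hlogpos : 0 ≤ Real.logb 2 ((n : ℝ) + 1) := Real.logb_nonneg one_lt_two (by linarith)
    have hI := mutualInfo_le_of_near hn hQs hV.1 hP hnear
    have hcard' : ((C.filter fun w => w ∈ typeClass n (outputDist Q V)).card : ℝ) ≤
        ((n : ℝ) + 1) ^ 4 * (((n : ℝ) + 1) ^ K * Real.exp (n * Real.log 2 * mutualInfo Q V)) := by
      refine le_trans ?_ (hcard.trans (mul_le_mul_of_nonneg_right hA (by positivity)))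
      exact_mod_cast card_filter_le _ _
    -- The `4` comes from `log |S| + 1 ≤ (n+1)^4` and one `K` from the number of conditional types;
    -- continuity of mutual information adds `2 K`.
    have hlogb : Real.logb 2 (C.filter fun w => w ∈ typeClass n (outputDist Q V)).card ≤
        4 * Real.logb 2 (n + 1) + (K * Real.logb 2 (n + 1) + n * mutualInfo Q V) := by
      obtain ⟨u₀, hu₀⟩ := hQ
      obtain ⟨w₀, hw₀, -⟩ := hcover u₀ hu₀
      have hpos : (0 : ℝ) < (C.filter fun w => w ∈ typeClass n (outputDist Q V)).card := by
        exact_mod_cast card_pos.2 ⟨w₀, hw₀⟩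
      refine (Real.logb_le_logb_of_le one_lt_two hpos hcard').trans (le_of_eq ?_)
      rw [Real.logb_mul (by positivity) (by positivity),
        Real.logb_mul (by positivity) (by positivity), Real.logb_pow, Real.logb_pow]
      congr 2
      rw [Real.logb, Real.log_exp]
      field_simp
    calc _ ≤ 1 / (n : ℝ) *
          (4 * Real.logb 2 (n + 1) + (K * Real.logb 2 (n + 1) + n * mutualInfo Q V)) :=
          mul_le_mul_of_nonneg_left hlogb (by positivity)
      _ = mutualInfo Q V + (K + 4) * (Real.logb 2 (n + 1) / n) := by field_simp; ring
      _ ≤ _ := by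
        rw [hK]
        push_cast
        linarith

end TypeCovering

-- Divergence cost of rounding one cell.

section RateDistortion

/-- The two-term log-sum inequality, from `log t ≤ t - 1`. The positivity hypotheses exclude a
positive numerator over `0`, where the convention for division would falsify the cost. -/
theorem add_mul_log_div_add_le {a e B C : ℝ} (ha : 0 ≤ a) (he : 0 ≤ e) (hB : 0 ≤ B)
    (hC : 0 ≤ C) (haB : 0 < a → 0 < B) (heC : 0 < e → 0 < C) :
    (a + e) * Real.log ((a + e) / (B + C)) ≤
      a * Real.log (a / B) + e * Real.log (e / C) := by
  have key : ∀ x D, 0 ≤ x → 0 ≤ D → (0 < x → 0 < D) → 0 < a + e → 0 < B + C →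
      x - D * ((a + e) / (B + C)) + x * Real.log ((a + e) / (B + C)) ≤ x * Real.log (x / D) := by
    intro x D hx hD hxD hs hS
    have hratio : 0 < (a + e) / (B + C) := div_pos hs hS
    rcases hx.eq_or_lt with rfl | hx
    · have := mul_nonneg hD hratio.le
      simp only [zero_mul]
      linarith
    · have hD := hxD hx
      have h := Real.log_le_sub_one_of_pos (x := D * ((a + e) / (B + C)) / x) (by positivity)
      rw [Real.log_div (by positivity) hx.ne', Real.log_mul hD.ne' hratio.ne'] at h
      have h2 := mul_le_mul_of_nonneg_left h hx.le
      rw [mul_sub _ _ 1, mul_div_cancel₀ _ hx.ne'] at h2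
      rw [Real.log_div hx.ne' hD.ne']
      linarith
  rcases (add_nonneg ha he).eq_or_lt with h | h
  · have ha0 : a = 0 := by linarith
    have he0 : e = 0 := by linarith
    simp [ha0, he0]
  · have hS : 0 < B + C := by
      rcases ha.eq_or_lt with h0 | h0
      · have := heC (by linarith)
        linarith
      · have := haB h0
        linarith
    have h1 := key a B ha hB haB h hS
    have h2 := key e C he hC heC h hS
    have h3 : B * ((a + e) / (B + C)) + C * ((a + e) / (B + C)) = a + e := by
      field_simp
    linarith

theorem sum_mul_log_div_nonneg {γ : Type*} [Fintype γ] {U r : γ → ℝ} (hU : U ∈ stdSimplex ℝ γ)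
    (hr : r ∈ stdSimplex ℝ γ) (h : ∀ z, 0 < U z → 0 < r z) :
    0 ≤ ∑ z, U z * Real.log (U z / r z) := by
  have key : ∀ z, U z - r z ≤ U z * Real.log (U z / r z) := by
    intro z
    rcases (hU.1 z).eq_or_lt with h0 | h0
    · simpa [← h0] using hr.1 z
    · have hrz := h z h0
      have h1 := Real.log_le_sub_one_of_pos (div_pos hrz h0)
      rw [← inv_div, Real.log_inv] at h1
      have h2 := mul_le_mul_of_nonneg_left h1 h0.le
      rw [inv_div, mul_sub, mul_div_cancel₀ _ h0.ne'] at h2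
      linarith
  have := sum_le_sum fun z (_ : z ∈ univ) => key z
  rwa [sum_sub_distrib, hU.2, hr.2, sub_self] at this

/-- Less than one unit is lost, so the term with `log c` changes by at most `log n`, while `x log x`
rises by at most `1`, its minimum being above `-1`. -/
theorem floor_mul_log_le {t c n : ℝ} (ht : 0 < t) (hc : 0 < c) (hcn : c ≤ n) (hn : 1 ≤ n) :
    (⌊t⌋₊ : ℝ) * Real.log (⌊t⌋₊ / c) ≤ t * Real.log (t / c) + (Real.log n + 1) := by
  have h1 := Nat.floor_le ht.le
  have h2 := Nat.lt_floor_add_one t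
  have hlogn : 0 ≤ Real.log n := Real.log_nonneg hn
  have hlogc : Real.log c ≤ Real.log n := Real.log_le_log hc hcn
  have h3 : (t - ⌊t⌋₊) * Real.log c ≤ Real.log n := by
    nlinarith
  have h4 : (⌊t⌋₊ : ℝ) * Real.log (⌊t⌋₊ / c) =
      ⌊t⌋₊ * Real.log ⌊t⌋₊ - ⌊t⌋₊ * Real.log c := by
    rcases Nat.eq_zero_or_pos ⌊t⌋₊ with h | h
    · simp [h]
    · rw [Real.log_div (by positivity) hc.ne']
      ring
  have h5 : (⌊t⌋₊ : ℝ) * Real.log ⌊t⌋₊ ≤ t * Real.log t + 1 := by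
    rcases Nat.eq_zero_or_pos ⌊t⌋₊ with h | h
    · have := negMulLog_le_tangent ht.le one_pos
      simp only [Real.negMulLog, inv_one, Real.log_one] at this
      rw [h]
      simp only [Nat.cast_zero, zero_mul]
      linarith
    · have h6 : (1 : ℝ) ≤ ⌊t⌋₊ := by exact_mod_cast h
      have h7 := mul_le_mul h1 (Real.log_le_log (by linarith) h1) (Real.log_nonneg h6) ht.le
      linarith
  rw [h4, Real.log_div ht.ne' hc.ne']
  linarith

/-- Rounding a reproduction law `U` in a cell of size `N`, where `n p` is close to `N`, sending
the remainder to the letter `z₀`. -/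
theorem exists_cell_counts {γ : Type*} [Fintype γ] {n N : ℕ} (hn : 2 ≤ n) (hNn : N ≤ n)
    {p κ : ℝ} (hp : 0 ≤ p) (hκ : 0 ≤ κ) (hNp : N ≤ n * p + κ) {U r r₀ : γ → ℝ}
    (hU : U ∈ stdSimplex ℝ γ) (hr : r ∈ stdSimplex ℝ γ) (hr₀ : ∀ z, 0 ≤ r₀ z)
    (hUr : 0 < p → ∀ z, 0 < U z → 0 < r z) (z₀ : γ) {k : ℝ} (hk : 1 ≤ k) (hz₀ : 1 / k ≤ r₀ z₀) :
    ∃ N' : γ → ℕ, ∑ z, N' z = N ∧ (∀ z, z ≠ z₀ → (N' z : ℝ) ≤ n * p * U z) ∧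
      (∀ z, 0 < N' z → 0 < (1 - 1 / (n : ℝ)) * r z + 1 / n * r₀ z) ∧
      ∑ z, N' z * Real.log (N' z / (N * ((1 - 1 / (n : ℝ)) * r z + 1 / n * r₀ z))) ≤
        n * (p * ∑ z, U z * Real.log (U z / r z)) + N * (2 / n) +
          Fintype.card γ * (Real.log n + 1) +
          (κ + Fintype.card γ) * (Real.log k + Real.log n) := by
  classical
  have hn' : (2 : ℝ) ≤ n := by exact_mod_cast hn
  have hn0 : (0 : ℝ) < n := by linarith
  have hτ : 0 < 1 - 1 / (n : ℝ) := by
    rw [sub_pos, div_lt_one hn0]; linarith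
  have hlogn : 0 ≤ Real.log n := Real.log_nonneg (by linarith)
  have hlogk : 0 ≤ Real.log k := Real.log_nonneg hk
  -- Rounding down `m U` keeps the total within the cell size `N` and each count within `n p U`. The
  -- leftover `e` is then at most `κ + |γ|`.
  set m : ℝ := min (n * p) N with hm
  have hm0 : 0 ≤ m := le_min (by positivity) (Nat.cast_nonneg _)
  have hmN : m ≤ N := min_le_right _ _
  have hmp : m ≤ n * p := min_le_left _ _
  set a : γ → ℕ := fun z => ⌊m * U z⌋₊ with ha
  have ht0 : ∀ z, 0 ≤ m * U z := fun z => mul_nonneg hm0 (hU.1 z)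
  have ha_le : ∀ z, (a z : ℝ) ≤ m * U z := fun z => Nat.floor_le (ht0 z)
  have hsumt : ∑ z, m * U z = m := by rw [← mul_sum, hU.2, mul_one]
  have hsuma : (∑ z, (a z : ℝ)) ≤ m := hsumt ▸ sum_le_sum fun z _ => ha_le z
  have hsuma' : ∑ z, a z ≤ N := by exact_mod_cast hsuma.trans hmN
  obtain ⟨e, he⟩ := Nat.exists_eq_add_of_le hsuma'
  have heN : (e : ℝ) ≤ N := by exact_mod_cast (by omega : e ≤ N)
  have heκ : (e : ℝ) ≤ κ + Fintype.card γ := by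
    have h1 : m ≤ (∑ z, (a z : ℝ)) + Fintype.card γ := by
      have : ∑ z, m * U z ≤ ∑ z, ((a z : ℝ) + 1) :=
        sum_le_sum fun z _ => (Nat.lt_floor_add_one _).le
      rw [sum_add_distrib, hsumt] at this
      simpa using this
    have h2 : (N : ℝ) = (∑ z, (a z : ℝ)) + e := by exact_mod_cast he
    have h3 : (N : ℝ) - κ ≤ m := le_min (by linarith) (by linarith)
    linarith
  have hpos : ∀ z, 0 < a z → 0 < m * U z ∧ 0 < m ∧ 0 < U z ∧ 0 < r z := by
    intro z hz
    have h1 : 0 < m * U z := lt_of_lt_of_le (by exact_mod_cast hz) (ha_le z)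
    have h2 : 0 < m := hm0.lt_of_ne fun h => by simp [← h] at h1
    have h3 : 0 < U z := (hU.1 z).lt_of_ne fun h => by simp [← h] at h1
    have h4 : 0 < p := hp.lt_of_ne fun h => by rw [← h] at hmp; linarith
    exact ⟨h1, h2, h3, hUr h4 z h3⟩
  have hpart : ∀ z, 0 ≤ (1 - 1 / (n : ℝ)) * r z ∧ 0 ≤ 1 / n * r₀ z := fun z =>
    ⟨mul_nonneg hτ.le (hr.1 z), mul_nonneg (by positivity) (hr₀ z)⟩
  have hz₀pos : 0 < r₀ z₀ := lt_of_lt_of_le (by positivity) hz₀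
  refine ⟨fun z => a z + if z = z₀ then e else 0, ?_, ?_, ?_, ?_⟩
  · rw [sum_add_distrib, sum_ite_eq' univ z₀, if_pos (mem_univ _), he]
  · intro z hz
    simp only [if_neg hz, add_zero]
    exact (ha_le z).trans (mul_le_mul_of_nonneg_right hmp (hU.1 z))
  · intro z hz
    by_cases haz : 0 < a z
    · exact add_pos_of_pos_of_nonneg (mul_pos hτ (hpos z haz).2.2.2) (hpart z).2
    · have : z = z₀ := by
        by_contra h
        simp only [if_neg h] at hz
        omega
      subst this
      exact add_pos_of_nonneg_of_pos (hpart z).1 (by positivity)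
  · have hlogτ : Real.log (1 - 1 / (n : ℝ))⁻¹ ≤ 2 / n := by
      refine (Real.log_le_sub_one_of_pos (inv_pos.2 hτ)).trans ?_
      have h1 : (n : ℝ) - 1 ≠ 0 := by linarith
      have h2 : (1 - 1 / (n : ℝ))⁻¹ - 1 = 1 / (n - 1) := by
        field_simp
        ring
      rw [h2, div_le_div_iff₀ (by linarith) hn0]
      linarith
    -- By the log-sum inequality the rounded part is charged to `(1 - 1/n) r` and the leftover to
    -- `r₀ / n`. The latter costs at most `log (k n)` per position, as `e ≤ N` and `r₀ z₀ ≥ 1/k`.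
    have hterm : ∀ z, ((a z + if z = z₀ then e else 0 : ℕ) : ℝ) *
        Real.log ((a z + if z = z₀ then e else 0 : ℕ) /
          (N * ((1 - 1 / (n : ℝ)) * r z + 1 / n * r₀ z))) ≤
        (m * (U z * Real.log (U z / r z)) + (Real.log n + 1) + a z * (2 / n)) +
          if z = z₀ then e * (Real.log k + Real.log n) else 0 := by
      intro z
      have h1 := add_mul_log_div_add_le (a := a z) (e := ((if z = z₀ then e else 0 : ℕ) : ℝ))
        (B := N * ((1 - 1 / (n : ℝ)) * r z)) (C := N * (1 / n * r₀ z)) (Nat.cast_nonneg _)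
        (Nat.cast_nonneg _) (mul_nonneg (Nat.cast_nonneg _) (hpart z).1)
        (mul_nonneg (Nat.cast_nonneg _) (hpart z).2)
        (fun h => by
          have h := hpos z (by exact_mod_cast h)
          exact mul_pos (h.2.1.trans_le hmN) (mul_pos hτ h.2.2.2))
        (fun h => by
          by_cases hz : z = z₀
          · subst hz
            simp only [if_true] at h
            exact mul_pos (h.trans_le heN) (by positivity)
          · simp [hz] at h)
      rw [← mul_add] at h1
      push_cast at h1 ⊢
      refine h1.trans (add_le_add ?_ ?_)
      · rcases (ht0 z).eq_or_lt with h0 | h0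
        · have haz : a z = 0 := by simp [ha, ← h0]
          rw [haz, ← mul_assoc m, ← h0, Nat.cast_zero, zero_mul, zero_mul, zero_mul]
          positivity
        · have hm1 : 0 < m := hm0.lt_of_ne fun h => by simp [← h] at h0
          have hU1 : 0 < U z := (hU.1 z).lt_of_ne fun h => by simp [← h] at h0
          have hp1 : 0 < p := hp.lt_of_ne fun h => by rw [← h] at hmp; linarith
          have hr1 := hUr hp1 z hU1
          have hrle := le_one_of_mem_stdSimplex hr z
          have hmn : m ≤ n := hmN.trans (by exact_mod_cast hNn)
          have h2 := floor_mul_log_le (c := m * r z) (n := n) h0 (mul_pos hm1 hr1)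
            ((mul_le_of_le_one_right hm0 hrle).trans hmn) (by linarith)
          have h3 : m * U z / (m * r z) = U z / r z := by field_simp
          rw [h3, mul_assoc m] at h2
          rcases Nat.eq_zero_or_pos (a z) with h4 | h4
          · rw [h4]
            have h5 : ⌊m * U z⌋₊ = 0 := h4
            rw [h5] at h2
            simpa using h2
          · have h4' : (0 : ℝ) < a z := by exact_mod_cast h4
            have hN1 : (0 : ℝ) < N := hm1.trans_le hmN
            have h5 : Real.log (a z / (N * ((1 - 1 / (n : ℝ)) * r z))) ≤
                Real.log (a z / (m * r z)) + 2 / n := by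
              refine le_trans ?_ (add_le_add_right hlogτ _)
              rw [← Real.log_mul (by positivity) (by positivity)]
              refine Real.log_le_log (by positivity) ?_
              rw [← div_eq_mul_inv, div_div]
              refine div_le_div_of_nonneg_left h4'.le (by positivity) ?_
              have := mul_le_mul_of_nonneg_right hmN (hpart z).1
              linarith
            have h6 := mul_le_mul_of_nonneg_left h5 h4'.le
            rw [mul_add] at h6
            have h7 : (a z : ℝ) * Real.log (a z / (m * r z)) ≤
              m * (U z * Real.log (U z / r z)) + (Real.log n + 1) := h2
            linarith
      · by_cases hz : z = z₀
        · subst hz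
          simp only [if_true]
          rcases Nat.eq_zero_or_pos e with h2 | h2
          · simp [h2]
          · have h2' : (0 : ℝ) < e := by exact_mod_cast h2
            refine mul_le_mul_of_nonneg_left ?_ h2'.le
            rw [← Real.log_mul (by positivity) (by positivity)]
            have hN1 : (0 : ℝ) < N := h2'.trans_le heN
            refine Real.log_le_log (by positivity) ?_
            rw [div_le_iff₀ (by positivity)]
            calc (e : ℝ) ≤ N := heN
              _ = k * n * (N * (1 / n * (1 / k))) := by field_simp
              _ ≤ k * n * (N * (1 / n * r₀ z)) := by gcongr
        · simp [hz]
    refine (sum_le_sum fun z _ => hterm z).trans ?_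
    rw [sum_add_distrib, sum_ite_eq' univ z₀, if_pos (mem_univ _), sum_add_distrib,
      sum_add_distrib, ← mul_sum, ← sum_mul]
    simp only [sum_const, card_univ, nsmul_eq_mul]
    -- The divergence is nonnegative, so its weight `m` may be raised to `n p`.
    have h1 : m * ∑ z, U z * Real.log (U z / r z) ≤
        n * (p * ∑ z, U z * Real.log (U z / r z)) := by
      rcases hp.eq_or_lt with h | h
      · have : m = 0 := le_antisymm (by rw [← h] at hmp; simpa using hmp) hm0
        simp [this, ← h]
      · rw [← mul_assoc]
        exact mul_le_mul_of_nonneg_right hmp (sum_mul_log_div_nonneg hU hr (hUr h))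
    have h2 : (∑ z, (a z : ℝ)) * (2 / n) ≤ N * (2 / n) :=
      mul_le_mul_of_nonneg_right (hsuma.trans hmN) (by positivity)
    have h3 : (e : ℝ) * (Real.log k + Real.log n) ≤
        (κ + Fintype.card γ) * (Real.log k + Real.log n) :=
      mul_le_mul_of_nonneg_right heκ (by positivity)
    linarith

end RateDistortion

-- Private codebooks given the side information.

section ConditionalCovering

/-- Counts of a conditional type whose distortion is at most that of the channel `U`, and whose
divergence from a product law depending only on the side information is about the conditional
mutual information of `U`. -/
theorem exists_counts_of_channel {α ω γ : Type*} [Fintype α] [Fintype ω] [Fintype γ]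
    {d : α → γ → ℝ} (hd : ∀ a z, 0 ≤ d a z) (hdz : ∀ a, ∃ z, d a z = 0) {n : ℕ} (hn : 2 ≤ n)
    {p : α × ω → ℝ} (hp : ∀ q, 0 ≤ p q) {N : α × ω → ℕ} (hN : ∑ q, N q = n) {κ : ℝ} (hκ : 0 ≤ κ)
    (hNp : ∀ q, (N q : ℝ) ≤ n * p q + κ) {U : α × ω → γ → ℝ} (hU : ∀ q, U q ∈ stdSimplex ℝ γ) :
    ∃ (N' : (α × ω) × γ → ℕ) (R : ω → γ → ℝ), (∀ w, R w ∈ stdSimplex ℝ γ) ∧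
      (∀ q, ∑ z, N' (q, z) = N q) ∧ (∀ q, 0 < N' q → 0 < R q.1.2 q.2) ∧
      ∑ q, N' q * d q.1.1 q.2 ≤ n * expectedDistortion d p U ∧
      ∑ q, N' q * Real.log (N' q / (N q.1 * R q.1.2 q.2)) ≤
        n * (condMutualInfo p U * Real.log 2) + 2 +
          Fintype.card α * Fintype.card ω * (Fintype.card γ * (Real.log n + 1) +
            (κ + Fintype.card γ) * (Real.log (Fintype.card α) + Real.log n)) := by
  classical
  have hn' : (2 : ℝ) ≤ n := by exact_mod_cast hn
  have hn0 : (0 : ℝ) < n := by linarith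
  have hα : Nonempty α := by
    by_contra h
    rw [not_nonempty_iff] at h
    simp at hN
    omega
  have hk : (1 : ℝ) ≤ Fintype.card α := by exact_mod_cast Fintype.card_pos (α := α)
  choose z₀ hz₀ using hdz
  -- The law of the zero-distortion letter of a uniform source letter: it charges every such letter
  -- with at least `1/|α|`, without knowing the source letter.
  set r₀ : γ → ℝ := fun z => ((univ.filter fun a => z₀ a = z).card : ℝ) / Fintype.card α with hr₀d
  have hr₀ : r₀ ∈ stdSimplex ℝ γ := by
    refine ⟨fun z => by positivity, ?_⟩
    have := card_eq_sum_card_fiberwise (f := z₀) (s := univ) (t := univ) (by simp)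
    simp only [hr₀d]
    rw [← sum_div, ← Nat.cast_sum, ← this, card_univ, div_self (by positivity)]
  have hr₀z : ∀ a, 1 / (Fintype.card α : ℝ) ≤ r₀ (z₀ a) := by
    intro a
    refine div_le_div_of_nonneg_right ?_ (by positivity)
    exact_mod_cast card_pos.2 ⟨a, by simp⟩
  -- Where the side information has probability zero, `condOutputDist` is `0/0 = 0` and not a
  -- distribution.
  set r : ω → γ → ℝ := fun w => if ∑ a, p (a, w) = 0 then r₀ else condOutputDist p U w with hrd
  have hsum0 : ∀ w, 0 ≤ ∑ a, p (a, w) := fun w => sum_nonneg fun a _ => hp _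
  have hr : ∀ w, r w ∈ stdSimplex ℝ γ := by
    intro w
    by_cases h : ∑ a, p (a, w) = 0
    · simpa only [hrd, if_pos h] using hr₀
    · simp only [hrd, if_neg h]
      refine ⟨fun z => div_nonneg (sum_nonneg fun a _ => mul_nonneg (hp _) ((hU _).1 z))
        (hsum0 w), ?_⟩
      simp only [condOutputDist]
      rw [← sum_div, sum_comm]
      simp only [← mul_sum, (hU _).2, mul_one]
      exact div_self h
  have hpw : ∀ q : α × ω, 0 < p q → r q.2 = condOutputDist p U q.2 ∧ 0 < ∑ a, p (a, q.2) := by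
    intro q hq
    have : 0 < ∑ a, p (a, q.2) :=
      hq.trans_le (single_le_sum (f := fun a => p (a, q.2)) (fun a _ => hp _) (mem_univ q.1))
    exact ⟨if_neg this.ne', this⟩
  have hUr : ∀ q : α × ω, 0 < p q → ∀ z, 0 < U q z → 0 < r q.2 z := by
    intro q hq z hz
    rw [(hpw q hq).1]
    refine div_pos ((mul_pos hq hz).trans_le ?_) (hpw q hq).2
    exact single_le_sum (f := fun a => p (a, q.2) * U (a, q.2) z)
      (fun a _ => mul_nonneg (hp _) ((hU _).1 z)) (mem_univ q.1)
  have hNn : ∀ q, N q ≤ n := fun q => by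
    rw [← hN]
    exact single_le_sum (f := N) (fun _ _ => Nat.zero_le _) (mem_univ q)
  choose N' hN'sum hN'le hN'pos hN'log using fun q : α × ω =>
    exists_cell_counts hn (hNn q) (hp q) hκ (hNp q) (hU q) (hr q.2) hr₀.1 (hUr q) (z₀ q.1) hk
      (hr₀z q.1)
  have hτ : 0 ≤ 1 - 1 / (n : ℝ) := by
    rw [sub_nonneg, div_le_one hn0]; linarith
  refine ⟨fun q => N' q.1 q.2, fun w z => (1 - 1 / (n : ℝ)) * r w z + 1 / n * r₀ z, fun w => ?_,
    hN'sum, fun q hq => hN'pos q.1 q.2 hq, ?_, ?_⟩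
  · refine ⟨fun z => add_nonneg (mul_nonneg hτ ((hr w).1 z))
      (mul_nonneg (by positivity) (hr₀.1 z)), ?_⟩
    rw [sum_add_distrib, ← mul_sum, ← mul_sum, (hr w).2, hr₀.2]
    ring
  · rw [Fintype.sum_prod_type, Fintype.sum_prod_type]
    simp only [expectedDistortion, mul_sum]
    refine sum_le_sum fun a _ => sum_le_sum fun w _ => sum_le_sum fun z _ => ?_
    -- The leftover positions sit at `z₀ a`, where the distortion vanishes; all other counts are at
    -- most those of the channel.
    by_cases h : z = z₀ a
    · rw [h, hz₀]
      simp
    · refine (mul_le_mul_of_nonneg_right (hN'le (a, w) z h) (hd a z)).trans (le_of_eq ?_)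
      ring
  · rw [Fintype.sum_prod_type]
    refine (sum_le_sum fun q _ => hN'log q).trans (le_of_eq ?_)
    have h1 : ∑ q : α × ω, p q * ∑ z, U q z * Real.log (U q z / r q.2 z) =
        condMutualInfo p U * Real.log 2 := by
      rw [Fintype.sum_prod_type]
      simp only [condMutualInfo, sum_mul, mul_sum]
      refine sum_congr rfl fun a _ => sum_congr rfl fun w _ => sum_congr rfl fun z _ => ?_
      rcases (hp (a, w)).eq_or_lt with h | h
      · simp [← h]
      · rw [(hpw _ h).1, Real.logb, mul_assoc (p _ * U _ _),
          div_mul_cancel₀ _ (Real.log_pos one_lt_two).ne', mul_assoc]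
    have h2 : ∑ q, (N q : ℝ) = n := by exact_mod_cast hN
    simp only [sum_add_distrib, ← mul_sum, ← sum_mul, h1, h2, sum_const, card_univ,
      nsmul_eq_mul, Fintype.card_prod]
    push_cast
    field_simp
    ring

theorem maxDistortion_nonneg {α γ : Type*} {d : α → γ → ℝ} (hd : ∀ a z, 0 ≤ d a z) :
    0 ≤ maxDistortion d :=
  Real.iSup_nonneg fun p => hd p.1 p.2

theorem le_maxDistortion {α γ : Type*} [Finite α] [Finite γ] (d : α → γ → ℝ) (a : α) (z : γ) :
    d a z ≤ maxDistortion d :=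
  le_ciSup (f := fun p : α × γ => d p.1 p.2) (Set.finite_range _).bddAbove (a, z)

theorem minPosDistortion_nonneg {α γ : Type*} (d : α → γ → ℝ) : 0 ≤ minPosDistortion d :=
  Real.sInf_nonneg fun _ hr => hr.1.le

/-- A positive maximum is one of the positive values, whose infimum is attained by finiteness. -/
theorem one_le_max_div_minPos {α γ : Type*} [Finite α] [Finite γ] {d : α → γ → ℝ}
    (h : 0 < maxDistortion d) : 1 ≤ maxDistortion d / minPosDistortion d := by
  have hne : Nonempty (α × γ) := by
    by_contra hempty
    rw [not_nonempty_iff] at hempty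
    simp [maxDistortion, Real.iSup_of_isEmpty] at h
  obtain ⟨q, hq⟩ := exists_eq_ciSup_of_finite (f := fun p : α × γ => d p.1 p.2)
  set S := {r | 0 < r ∧ ∃ a c, d a c = r} with hS
  have hmem : maxDistortion d ∈ S := ⟨h, q.1, q.2, hq⟩
  have hfin : S.Finite := (Set.finite_range fun p : α × γ => d p.1 p.2).subset
    fun r ⟨_, a, c, hr⟩ => ⟨(a, c), hr⟩
  have hpos : 0 < minPosDistortion d := (Set.Nonempty.csInf_mem ⟨_, hmem⟩ hfin).1
  rw [one_le_div hpos]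
  exact csInf_le hfin.bddBelow hmem

/-- Strict excess over the infimum yields a channel without asking whether it is attained. The
zero-distortion letters make the constraint set nonempty. -/
theorem exists_channel_of_condRateDistortion_lt {α ω γ : Type*} [Fintype α] [Fintype ω]
    [Fintype γ] {d : α → γ → ℝ} (hdz : ∀ a, ∃ z, d a z = 0) {D : ℝ} (hD : 0 ≤ D)
    {p : α × ω → ℝ} {R : ℝ} (h : condRateDistortion d p D < R) :
    ∃ U : α × ω → γ → ℝ, (∀ q, U q ∈ stdSimplex ℝ γ) ∧ expectedDistortion d p U ≤ D ∧
      condMutualInfo p U < R := by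
  classical
  obtain ⟨_, ⟨U, hU, hUD, rfl⟩, hr⟩ := exists_lt_of_csInf_lt (by
    choose z₀ hz₀ using hdz
    refine ⟨_, fun q z => if z = z₀ q.1 then 1 else 0, fun q => ⟨fun z => ?_, by simp⟩, ?_, rfl⟩
    · dsimp only
      split_ifs <;> norm_num
    · refine le_trans (le_of_eq ?_) hD
      simp [expectedDistortion, hz₀]) h
  exact ⟨U, hU, hUD, hr⟩

/-- The sum really spends `3 L log n`, `2 K log n` and less than `10 log n`. Bare multiples of `L`
are bounded by `L log 2 ≤ log n`, and what exceeds `5 log n` goes into the unused part of `11 K`,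
since `K ≥ 1`. -/
theorem covering_exponent_le {n : ℕ} (hn : 2 ≤ n) {k L K : ℝ} (hk : 2 ≤ k) (hL : 1 ≤ L)
    (hK : 1 ≤ K) (hLk : L * Real.log k ≤ Real.log n) {x E : ℝ} (hE : E ≤ x + Real.log n + 2 +
      (L * (Real.log n + 1) + (K + L) * (Real.log k + Real.log n))) :
    Real.log (n * k) + L * Real.log (n + 1) + E ≤ x + (11 * K + 3 * L + 5) * Real.log n := by
  have hn' : (2 : ℝ) ≤ n := by exact_mod_cast hn
  have hlog2 := Real.log_two_gt_d9
  have h1 : Real.log 2 ≤ Real.log k := Real.log_le_log two_pos hk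
  have h2 : Real.log 2 ≤ Real.log n := Real.log_le_log two_pos hn'
  have h3 : L * 0.69 ≤ Real.log n :=
    le_trans (mul_le_mul_of_nonneg_left (by linarith) (by linarith)) hLk
  have h4 : Real.log k ≤ Real.log n := le_trans (le_mul_of_one_le_left (by linarith) hL) hLk
  have h5 : Real.log (n + 1) ≤ Real.log n + 1 / 2 := by
    have h := Real.log_le_sub_one_of_pos (x := (n + 1) / n) (by positivity)
    rw [Real.log_div (by positivity) (by positivity)] at h
    have h6 : ((n : ℝ) + 1) / n - 1 = 1 / n := by field_simp; ring
    have h7 : 1 / (n : ℝ) ≤ 1 / 2 := one_div_le_one_div_of_le two_pos hn'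
    linarith
  have h6 : L * Real.log (n + 1) ≤ L * (Real.log n + 1 / 2) :=
    mul_le_mul_of_nonneg_left h5 (by linarith)
  have h7 : K * Real.log k ≤ K * Real.log n := mul_le_mul_of_nonneg_left h4 (by linarith)
  have h8 : Real.log n ≤ K * Real.log n := le_mul_of_one_le_left (by linarith) hK
  rw [Real.log_mul (by positivity) (by positivity)]
  linarith

theorem avgDistortion_eq_sum_count {α ω γ : Type*} [Fintype α] [DecidableEq α] [Fintype ω]
    [DecidableEq ω] [Fintype γ] [DecidableEq γ] (d : α → γ → ℝ) {n : ℕ} (x : Fin n → α)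
    (w : Fin n → ω) (z : Fin n → γ) :
    avgDistortion d x z = (∑ q, count (pairSeq (pairSeq x w) z) q * d q.1.1 q.2) / n := by
  rw [← sum_apply_eq_sum_count (pairSeq (pairSeq x w) z) fun q => d q.1.1 q.2]
  rfl

/-- Given side information `w`, the sequences whose joint type with `w` is `q` are covered within
distortion `D` by about `2^(n R)` sequences, when `q` is close to `p` and `R` is at least the
conditional rate-distortion function at `p`. -/
theorem exists_distortion_cover {α ω γ : Type*} [Fintype α] [DecidableEq α] [Fintype ω]
    [DecidableEq ω] [Fintype γ] {d : α → γ → ℝ} (hd : ∀ a z, 0 ≤ d a z)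
    (hdz : ∀ a, ∃ z, d a z = 0) {D : ℝ} (hD : 0 < D) {n : ℕ} (hn : 1 ≤ n)
    (hlog : (Fintype.card α : ℝ) * Fintype.card ω * Fintype.card γ *
      Real.logb 2 (Fintype.card α) * maxDistortion d / D ≤ Real.logb 2 n)
    {p q : α × ω → ℝ} (hp : ∀ a, 0 ≤ p a) {κ : ℕ} (hκ : 1 ≤ κ)
    (hpq : ∀ a, q a ≤ p a + κ / n) {R : ℝ} (hR : 0 ≤ R) (hrate : condRateDistortion d p D ≤ R)
    (w : Fin n → ω) :
    ∃ B : Finset (Fin n → γ),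
      (∀ x : Fin n → α, empirical (pairSeq x w) = q → ∃ z ∈ B, avgDistortion d x z ≤ D) ∧
      1 / (n : ℝ) * Real.logb 2 B.card ≤ R + (11 * maxDistortion d / minPosDistortion d *
        (Fintype.card α * κ * Fintype.card ω) +
        3 * Fintype.card α * Fintype.card ω * Fintype.card γ + 5) * (Real.logb 2 n / n) := by
  classical
  have hn0 : (0 : ℝ) < n := by positivity
  have hn1 : (1 : ℝ) ≤ n := by exact_mod_cast hn
  have hlog2 : 0 < Real.log 2 := Real.log_pos one_lt_two
  have hmax := maxDistortion_nonneg hd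
  have hmin := minPosDistortion_nonneg d
  have hlogbn : 0 ≤ Real.logb 2 n := Real.logb_nonneg one_lt_two hn1
  have hrhs : 0 ≤ R + (11 * maxDistortion d / minPosDistortion d *
      (Fintype.card α * κ * Fintype.card ω) +
      3 * Fintype.card α * Fintype.card ω * Fintype.card γ + 5) * (Real.logb 2 n / n) := by
    positivity
  by_cases hex : ∃ x : Fin n → α, empirical (pairSeq x w) = q
  swap
  -- Here `logb 2 0 = 0`, so the empty set satisfies the rate bound.
  · exact ⟨∅, fun x hx => (hex ⟨x, hx⟩).elim, by simpa using hrhs⟩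
  obtain ⟨x₀, hx₀⟩ := hex
  have hsingle : ∀ z : Fin n → γ, (∀ x, avgDistortion d x z ≤ D) →
      ∃ B : Finset (Fin n → γ),
      (∀ x : Fin n → α, empirical (pairSeq x w) = q → ∃ z ∈ B, avgDistortion d x z ≤ D) ∧
      1 / (n : ℝ) * Real.logb 2 B.card ≤ R + (11 * maxDistortion d / minPosDistortion d *
        (Fintype.card α * κ * Fintype.card ω) +
        3 * Fintype.card α * Fintype.card ω * Fintype.card γ + 5) * (Real.logb 2 n / n) :=
    fun z hz => ⟨{z}, fun x _ => ⟨z, mem_singleton_self z, hz x⟩, by simpa using hrhs⟩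
  choose z₀ hz₀ using hdz
  by_cases hα : Fintype.card α ≤ 1
  · refine hsingle (fun i => z₀ (x₀ i)) fun x => ?_
    have : x = x₀ := funext fun i => Fintype.card_le_one_iff.1 hα _ _
    simp [avgDistortion, this, hz₀, hD.le]
  by_cases hDmax : maxDistortion d ≤ D
  · refine hsingle (fun i => z₀ (x₀ i)) fun x => ?_
    rw [avgDistortion, div_le_iff₀ hn0]
    refine (sum_le_sum fun i _ => (le_maxDistortion d _ _).trans hDmax).trans (le_of_eq ?_)
    simp [mul_comm]
  push Not at hα hDmax
  set k : ℝ := ((Fintype.card α : ℕ) : ℝ) with hkd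
  set L : ℝ := k * Fintype.card ω * Fintype.card γ with hLd
  set K : ℝ := k * κ * Fintype.card ω with hKd
  have hk : 2 ≤ k := by
    rw [hkd]
    exact_mod_cast hα
  have hω : (1 : ℝ) ≤ Fintype.card ω := by
    exact_mod_cast Fintype.card_pos_iff.2 ⟨w ⟨0, hn⟩⟩
  have hγ : (1 : ℝ) ≤ Fintype.card γ := by
    exact_mod_cast Fintype.card_pos_iff.2 ⟨z₀ (x₀ ⟨0, hn⟩)⟩
  have hκ' : (1 : ℝ) ≤ κ := by exact_mod_cast hκ
  have hL : 1 ≤ L := one_le_mul_of_one_le_of_one_le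
    (one_le_mul_of_one_le_of_one_le (by linarith) hω) hγ
  have hK : 1 ≤ K := one_le_mul_of_one_le_of_one_le
    (one_le_mul_of_one_le_of_one_le (by linarith) hκ') hω
  have hlogk : 0 < Real.log k := Real.log_pos (by linarith)
  have hLk : L * Real.log k ≤ Real.log n := by
    have h1 : L * Real.logb 2 k ≤ L * Real.logb 2 k * maxDistortion d / D := by
      rw [mul_div_assoc]
      refine le_mul_of_one_le_right ?_ ((one_le_div hD).2 hDmax.le)
      exact mul_nonneg (by linarith) (Real.logb_nonneg one_lt_two (by linarith))
    have h2 := h1.trans hlog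
    rw [Real.logb, Real.logb, mul_div_assoc', div_le_div_iff_of_pos_right hlog2] at h2
    exact h2
  -- For `n = 1` the right side of `hLk` is `0`; the trivial cases removed above make the left side
  -- positive.
  have hn2 : 2 ≤ n := by
    by_contra h
    have : n = 1 := by omega
    rw [this, Nat.cast_one, Real.log_one] at hLk
    have := mul_pos (by linarith : 0 < L) hlogk
    linarith
  have hlogn : 0 < Real.log n := Real.log_pos (by exact_mod_cast hn2)
  -- The slack `log₂ n / n` in the rate costs one extra `log n` in the exponent.
  obtain ⟨U, hU, hUD, hUR⟩ := exists_channel_of_condRateDistortion_lt (fun a => ⟨z₀ a, hz₀ a⟩)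
    hD.le (hrate.trans_lt (lt_add_of_pos_right R
      (div_pos (div_pos hlogn hlog2) hn0 : 0 < Real.log n / Real.log 2 / n)))
  set N := count (pairSeq x₀ w) with hNd
  have hqN : q = fun a => (N a : ℝ) / n := hx₀.symm
  obtain ⟨N', S, hS, hN', hSpos, hdist, hE⟩ := exists_counts_of_channel hd
    (fun a => ⟨z₀ a, hz₀ a⟩) hn2 hp (sum_count (pairSeq x₀ w)) (κ := κ) (by linarith)
    (fun a => by
      have h := hpq a
      rw [hqN, div_le_iff₀ hn0, add_mul, div_mul_cancel₀ _ hn0.ne'] at h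
      linarith) hU
  -- The targets are the pairs `(x, w)` with `w` fixed. The sampling law sees only `w i`, so one law
  -- serves all `x`.
  obtain ⟨B, hB, hcard⟩ := exists_type_cover
    (univ.filter fun u : Fin n → α × ω => (∀ i, (u i).2 = w i) ∧ ∀ a, count u a = N a) N N'
    (by simp) hN' (fun i => S (w i)) (fun i => hS _) (fun q => S q.1.2 q.2)
    (by
      intro u hu i b
      simp only [mem_filter, mem_univ, true_and] at hu
      simp only [hu.1 i]) hSpos _ hE
  have hcover : ∀ x : Fin n → α, empirical (pairSeq x w) = q →
      ∃ z ∈ B, avgDistortion d x z ≤ D := by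
    intro x hx
    rw [hqN, empirical_eq_iff hn] at hx
    obtain ⟨z, hzB, hz⟩ := hB (pairSeq x w) (by simpa [pairSeq] using hx)
    refine ⟨z, hzB, ?_⟩
    rw [avgDistortion_eq_sum_count d x w z, div_le_iff₀ hn0]
    simp only [hz]
    rw [mul_comm D]
    exact hdist.trans (mul_le_mul_of_nonneg_left hUD hn0.le)
  refine ⟨B, hcover, ?_⟩
  -- At most `k^n` targets exist, and `n log k + 1 ≤ n (k - 1) + 1 ≤ n k`.
  have hA : Real.log (univ.filter fun u : Fin n → α × ω =>
      (∀ i, (u i).2 = w i) ∧ ∀ a, count u a = N a).card + 1 ≤ n * k := by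
    have hle : (univ.filter fun u : Fin n → α × ω =>
        (∀ i, (u i).2 = w i) ∧ ∀ a, count u a = N a).card ≤ Fintype.card α ^ n := by
      have h := card_le_card_of_injOn (s := univ.filter fun u : Fin n → α × ω =>
        (∀ i, (u i).2 = w i) ∧ ∀ a, count u a = N a) (t := (univ : Finset (Fin n → α)))
        (fun u i => (u i).1) (by simp) (by
          intro u hu v hv huv
          simp only [coe_filter, mem_univ, true_and, Set.mem_ofPred_eq] at hu hv
          funext i
          exact Prod.ext (congrFun huv i) ((hu.1 i).trans (hv.1 i).symm))
      simpa using h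
    have hpos : 0 < (univ.filter fun u : Fin n → α × ω =>
        (∀ i, (u i).2 = w i) ∧ ∀ a, count u a = N a).card :=
      card_pos.2 ⟨pairSeq x₀ w, by simp [pairSeq, hNd]⟩
    have h1 : Real.log (univ.filter fun u : Fin n → α × ω =>
        (∀ i, (u i).2 = w i) ∧ ∀ a, count u a = N a).card ≤ n * Real.log k := by
      rw [← Real.log_pow]
      refine Real.log_le_log (by exact_mod_cast hpos) ?_
      rw [hkd]
      exact_mod_cast hle
    have h2 := mul_le_mul_of_nonneg_left
      (Real.log_le_sub_one_of_pos (by linarith : 0 < k)) hn0.le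
    linarith
  obtain ⟨z, hzB, -⟩ := hcover x₀ hx₀
  have hBpos : (0 : ℝ) < B.card := by exact_mod_cast card_pos.2 ⟨z, hzB⟩
  have hlogB : Real.log B.card ≤
      n * Real.log 2 * R + (11 * K + 3 * L + 5) * Real.log n := by
    have h1 := Real.log_le_log hBpos
      (hcard.trans (mul_le_mul_of_nonneg_right hA (by positivity)))
    rw [Real.log_mul (x := n * k) (by positivity) (by positivity),
      Real.log_mul (x := ((n : ℝ) + 1) ^ _) (by positivity) (by positivity), Real.log_exp, Real.log_pow, Fintype.card_prod] at h1
    push_cast at h1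
    rw [← add_assoc] at h1
    refine h1.trans (covering_exponent_le hn2 hk hL hK hLk ?_)
    have h2 : n * (condMutualInfo p U * Real.log 2) ≤ n * Real.log 2 * R + Real.log n := by
      have := mul_le_mul_of_nonneg_left hUR.le (mul_pos hn0 hlog2).le
      have h3 : n * Real.log 2 * (R + Real.log n / Real.log 2 / n) =
          n * Real.log 2 * R + Real.log n := by field_simp
      linarith
    have h3 : k * Fintype.card ω * (Fintype.card γ * (Real.log n + 1) +
        (κ + Fintype.card γ) * (Real.log k + Real.log n)) =
        L * (Real.log n + 1) + (K + L) * (Real.log k + Real.log n) := by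
      rw [hLd, hKd]; ring
    rw [h3]
    linarith
  -- The distortion ratio in the constant is needed only through being at least `1`, which holds
  -- because `D` is below the maximum.
  have hρ := one_le_max_div_minPos (hD.trans hDmax)
  have hconst : 11 * K + 3 * L + 5 ≤ 11 * maxDistortion d / minPosDistortion d * K +
      3 * k * Fintype.card ω * Fintype.card γ + 5 := by
    have h1 : 11 * K ≤ 11 * K * (maxDistortion d / minPosDistortion d) :=
      le_mul_of_one_le_right (by linarith) hρ
    have h2 : 11 * maxDistortion d / minPosDistortion d * K =
        11 * K * (maxDistortion d / minPosDistortion d) := by ring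
    rw [h2, hLd]
    linarith
  calc 1 / (n : ℝ) * Real.logb 2 B.card
      ≤ 1 / n * ((n * Real.log 2 * R + (11 * K + 3 * L + 5) * Real.log n) / Real.log 2) := by
        rw [Real.logb]
        gcongr
    _ = R + (11 * K + 3 * L + 5) * (Real.logb 2 n / n) := by
        rw [Real.logb]
        field_simp
    _ ≤ _ := by
        gcongr

end ConditionalCovering

-- Marginals of a joint type of three sequences.

section Marginals

variable {α β ω : Type*} [DecidableEq α] [DecidableEq β] [DecidableEq ω] {n : ℕ}

theorem sum_empirical_triple_XW [Fintype β] (x : Fin n → α) (y : Fin n → β) (w : Fin n → ω) :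
    (fun p : α × ω => ∑ b, empirical (pairSeq (pairSeq x y) w) ((p.1, b), p.2)) =
      empirical (pairSeq x w) := by
  funext p
  rw [← sum_empirical_pairSeq_left y (pairSeq x w) p]
  refine Finset.sum_congr rfl fun b _ => ?_
  simp only [empirical, pairSeq, Prod.ext_iff, and_left_comm, and_assoc]

theorem sum_empirical_triple_YW [Fintype α] (x : Fin n → α) (y : Fin n → β) (w : Fin n → ω) :
    (fun p : β × ω => ∑ a, empirical (pairSeq (pairSeq x y) w) ((a, p.1), p.2)) =
      empirical (pairSeq y w) := by
  funext p
  rw [← sum_empirical_pairSeq_left x (pairSeq y w) p]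
  refine Finset.sum_congr rfl fun a _ => ?_
  simp only [empirical, pairSeq, Prod.ext_iff, and_assoc]

end Marginals

end GrayWyner

-- Assembly of the three covers.

theorem lemma5 {X Y W Xh Yh : Type*}
    [Fintype X] [DecidableEq X] [Fintype Y] [DecidableEq Y] [Fintype W] [DecidableEq W]
    [Fintype Xh] [Fintype Yh]
    (dX : X → Xh → ℝ) (dY : Y → Yh → ℝ)
    (hdX_nonneg : ∀ x z, 0 ≤ dX x z) (hdY_nonneg : ∀ y z, 0 ≤ dY y z)
    (hdX_zero : ∀ x, ∃ z, dX x z = 0) (hdY_zero : ∀ y, ∃ z, dY y z = 0)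
    (D₁ D₂ : ℝ) (hD₁ : 0 < D₁) (hD₂ : 0 < D₂)
    (n : ℕ) (hn : 1 ≤ n)
    (hn₀ : (n : ℝ) * Real.logb 2 ((Fintype.card X : ℝ) * Fintype.card Y) < ((n : ℝ) + 1) ^ 4)
    (hn₁ : (Fintype.card X : ℝ) * Fintype.card W * Fintype.card Xh *
      Real.logb 2 (Fintype.card X) * maxDistortion dX / D₁ ≤ Real.logb 2 n)
    (hn₂ : (Fintype.card Y : ℝ) * Fintype.card W * Fintype.card Yh *
      Real.logb 2 (Fintype.card Y) * maxDistortion dY / D₂ ≤ Real.logb 2 n)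
    (hn₃ : Real.logb 2 ((Fintype.card Xh : ℝ) / Fintype.card Y) ≤ Real.logb 2 n)
    (Q : X × Y → ℝ) (hQ : IsType n Q)
    (R₁ R₂ : ℝ) (hR₁ : 0 < R₁) (hR₂ : 0 < R₂)
    (hR₀ : ∃ P : X × Y → W → ℝ, AchievesMinCommonRate dX dY R₁ R₂ D₁ D₂ Q P) :
    ∃ V : X × Y → W → ℝ, IsCondType n Q V ∧
      (∃ C : Finset (Fin n → W),
        (C : Set (Fin n → W)) ⊆ typeClass n (outputDist Q V) ∧
        (∀ (x : Fin n → X) (y : Fin n → Y), pairSeq x y ∈ typeClass n Q →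
          ∃ w ∈ C, pairSeq (pairSeq x y) w ∈ typeClass n (jointDist Q V)) ∧
        1 / (n : ℝ) * Real.logb 2 C.card ≤
          minCommonRate dX dY R₁ R₂ D₁ D₂ Q + const₀ X Y W * (Real.logb 2 (n + 1) / n)) ∧
      (∀ w ∈ typeClass n (outputDist Q V),
        ∃ (BX : Finset (Fin n → Xh)) (BY : Finset (Fin n → Yh)),
          (∀ (x : Fin n → X) (y : Fin n → Y),
            pairSeq (pairSeq x y) w ∈ typeClass n (jointDist Q V) →
              (∃ z ∈ BX, avgDistortion dX x z ≤ D₁) ∧ (∃ z ∈ BY, avgDistortion dY y z ≤ D₂)) ∧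
          1 / (n : ℝ) * Real.logb 2 BX.card ≤ R₁ + const₁ Y W dX * (Real.logb 2 n / n) ∧
          1 / (n : ℝ) * Real.logb 2 BY.card ≤ R₂ + const₂ X W dY * (Real.logb 2 n / n)) := by

  have hn0 : (0 : ℝ) < n := by positivity
  obtain ⟨P, hP, hPX, hPY, hI⟩ := hR₀
  obtain ⟨V, hV, hnear, C, hCsub, hC, hCcard⟩ := exists_condType_cover hn hQ hP
    (by simpa [Fintype.card_prod] using hn₀)
  have hQ0 : ∀ p, 0 ≤ Q p := by
    obtain ⟨u, rfl⟩ := hQ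
    exact (empirical_mem_stdSimplex hn u).1
  obtain ⟨u₀, hu₀⟩ := hQ
  have hX : 1 ≤ Fintype.card X := Fintype.card_pos_iff.2 ⟨(u₀ ⟨0, hn⟩).1⟩
  have hY : 1 ≤ Fintype.card Y := Fintype.card_pos_iff.2 ⟨(u₀ ⟨0, hn⟩).2⟩
  have hnear' : ∀ a b, Q a * V a b ≤ Q a * P a b + 1 / n := fun a b => by
    linarith [(abs_le.1 (hnear a b)).2]
  refine ⟨V, hV, ⟨C, hCsub, fun x y hxy => hC _ hxy, ?_⟩, fun w _ => ?_⟩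
  · rw [← hI, const₀]
    refine hCcard.trans (le_of_eq ?_)
    rw [Fintype.card_prod]
    push_cast
    ring
  -- Summing the rounding error `1/n` over `y` gives `|Y|/n`, so `κ = |Y|` here; for the other
  -- decoder `κ = |X|`.
  obtain ⟨BX, hBX, hBXcard⟩ := exists_distortion_cover hdX_nonneg hdX_zero hD₁ hn hn₁
    (p := margXW Q P) (q := margXW Q V)
    (fun a => Finset.sum_nonneg fun y _ => mul_nonneg (hQ0 _) ((hP _).1 _)) hY
    (fun a => by
      refine (Finset.sum_le_sum fun y _ => hnear' (a.1, y) a.2).trans (le_of_eq ?_)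
      rw [Finset.sum_add_distrib]
      simp [margXW, div_eq_mul_inv]) hR₁.le hPX w
  obtain ⟨BY, hBY, hBYcard⟩ := exists_distortion_cover hdY_nonneg hdY_zero hD₂ hn hn₂
    (p := margYW Q P) (q := margYW Q V)
    (fun a => Finset.sum_nonneg fun x _ => mul_nonneg (hQ0 _) ((hP _).1 _)) hX
    (fun a => by
      refine (Finset.sum_le_sum fun x _ => hnear' (x, a.1) a.2).trans (le_of_eq ?_)
      rw [Finset.sum_add_distrib]
      simp [margYW, div_eq_mul_inv]) hR₂.le hPY w
  refine ⟨BX, BY, fun x y hxy => ⟨hBX x ?_, hBY y ?_⟩, hBXcard, ?_⟩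
  · rw [← sum_empirical_triple_XW x y w, hxy]
    rfl
  · rw [← sum_empirical_triple_YW x y w, hxy]
    rfl
  · refine hBYcard.trans (le_of_eq ?_)
    rw [const₂]
    ring
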